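/- **Setting.** For $n\in\mathbb N$ let $p=p_n$ and $r=r_n$ be integers with $1\le r\le R$ for a fixed $R$, let $\alpha_1,\dots,\alpha_p>1$ (possibly depending on $n$), $\alpha=\min_{i\le p}\alpha_i$, and $\tau_n=(n^{-1/2}\log p)^{(\alpha-1)/\alpha}$. On a probability space let $$\Gamma=\Theta+\Sigma,\qquad \Theta=\sum_{k=1}^r\bar\lambda_k\bar q_k\bar q_k^\top$$ be a random symmetric $p\times p$ matrix, where $\bar\lambda_1\ge\dots\ge\bar\lambda_r>0$, $\bar q_1,\dots,\bar q_r$ are orthonormal and $\Sigma$ is symmetric. Let $\lambda_1$ be the largest eigenvalue of $\Gamma$, $\bar\lambda_{r+1}=0$, $D_\lambda=\min_{1\le i\le r}(\bar\lambda_i-\bar\lambda_{i+1})$. Let $q\in[0,1)$, let $s_p$ be a deterministic function of $p$, let $M_\sigma>0$ be a random variable (possibly depending on $n$) with $E(M_\sigma^2)$ bounded in $n$, and put $\beta_n=M_\sigma s_p/p+\tau_n$. Write $\|A\|_2$ for the spectral norm, $\|A\|_{\max}=\max_{i,j}|A_{ij}|$, $\|A\|_F$ for the Frobenius norm and $\|A\|_\Gamma=p^{-1/2}\|\Gamma^{-1/2}A\Gamma^{-1/2}\|_F$.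 **Assumptions.** There are fixed constants $C_1,C_3$ and $C_2,c_0,C_0>0$ such that for all large $n$, almost surely, - $\max_i\sum_{j}|\Sigma_{ij}|^q(\Sigma_{ii}\Sigma_{jj})^{(1-q)/2}\le M_\sigma s_p$ (with $0^0=0$); - $(\lambda_1+pM_\sigma)/D_\lambda\le C_1$ and $D_\lambda\ge C_2p$; - $\frac pr\max_{i}\sum_{k=1}^r\bar q_{ik}^2\le C_3$, where $\bar q_{ik}$ is the $i$-th entry of $\bar q_k$; - every eigenvalue of $\Sigma$ is at least $c_0$; moreover $s_p/\sqrt p+\tau_n\to0$ as $n\to\infty$, and the symmetric input estimator $\hat\Gamma$ satisfies, for all large $n$, $\Pr\{\|\hat\Gamma-\Gamma\|_{\max}\ge C_0\tau_n\}\le p^{-1}$. **Estimator.** Let $\hat\Gamma=\sum_{k=1}^p\hat\lambda_k\hat q_k\hat q_k^\top$ be a spectral decomposition with $\hat\lambda_1\ge\dots\ge\hat\lambda_p$, $\hat\Theta=\sum_{k=1}^r\hat\lambda_k\hat q_k\hat q_k^\top$ and $\tilde\Sigma=\hat\Gamma-\hat\Theta$. With $\varpi_n=C_\varpi\beta_n$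 and $\varpi_{ij}=\varpi_n\sqrt{(\tilde\Sigma_{ii}\vee0)(\tilde\Sigma_{jj}\vee0)}$, set $\hat\Sigma_{ii}=\tilde\Sigma_{ii}\vee0$ and $\hat\Sigma_{ij}=s_{ij}(\tilde\Sigma_{ij})\mathbf 1(|\tilde\Sigma_{ij}|\ge\varpi_{ij})$ for $i\ne j$, where $s_{ij}$ are any (possibly data-dependent) functions with $|s_{ij}(y)-y|\le\varpi_{ij}$ for all $y$. Let $\hat\Gamma_{POET}=\hat\Theta+\hat\Sigma$. **Claim.** Let $\nu$ be a real number. There is $W>0$ depending only on $C_1,C_2,C_3,c_0,C_0,q,R,\nu$ such that for every $C_\varpi\ge W$ there are $C,c>0$, depending only on these constants and $C_\varpi$, for which the following hold. 1. For all sufficiently large $n$, with probability greater than $1-2p^{-1}$, $$\|\hat\Sigma-\Sigma\|_2\le CM_\sigma s_p\beta_n^{1-q},\qquad \|\hat\Gamma_{POET}-\Gamma\|_\Gamma\le C\big[p^{1/2}(n^{-1/2}\log p)^{(2\alpha-2)/\alpha}+M_\sigma s_p\beta_n^{1-q}\big].$$ 2. If moreover $\max_i\Sigma_{ii}\le\nu$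 almost surely for all large $n$, then for all sufficiently large $n$, with probability greater than $1-2p^{-1}$, the two bounds of 1 hold together with $$\|\hat\Sigma-\Sigma\|_{\max}\le C\beta_n,\qquad \|\hat\Gamma_{POET}-\Gamma\|_{\max}\le C\beta_n.$$ 3. If $M_\sigma s_p\beta_n^{1-q}\to0$ in probability, then with probability tending to $1$ every eigenvalue of $\hat\Sigma$ is at least $c$ (every real eigenvalue, should $\hat\Sigma$ not be symmetric; in particular $\hat\Sigma$ is invertible), $\hat\Gamma_{POET}$ is invertible, and $$\|\hat\Sigma^{-1}-\Sigma^{-1}\|_2\le CM_\sigma s_p\beta_n^{1-q},\qquad \|\hat\Gamma_{POET}^{-1}-\Gamma^{-1}\|_2\le CM_\sigma s_p\beta_n^{1-q}.$$ -/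

import Mathlib

open MeasureTheory Filter Topology

namespace POET

noncomputable section

/-- `A = ∑ₖ λₖ vₖ vₖᵀ` with `λ₁ ≥ λ₂ ≥ …` and orthonormal `v₁, v₂, …`. -/
structure IsSpectralDecomposition {p m : ℕ} (A : Matrix (Fin p) (Fin p) ℝ)
    (lam : Fin m → ℝ) (v : Fin m → EuclideanSpace ℝ (Fin p)) : Prop where
  antitone : Antitone lam
  orthonormal : Orthonormal ℝ v
  eq_sum : A = ∑ k, lam k • Matrix.vecMulVec (v k).ofLp (v k).ofLp

/-- The largest eigenvalue of a symmetric matrix. -/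
def largestEigenvalue {p : ℕ} (A : Matrix (Fin p) (Fin p) ℝ) : ℝ :=
  sSup (spectrum ℝ A)

/-- `min {λᵢ - λᵢ₊₁ : 1 ≤ i ≤ r}` with the convention `λᵣ₊₁ = 0`. -/
def eigengap {r : ℕ} (lam : Fin r → ℝ) : ℝ :=
  ⨅ i : Fin r, (lam i - if h : (i : ℕ) + 1 < r then lam ⟨i + 1, h⟩ else 0)

/-- `|x| ^ q` with the convention `0 ^ 0 = 0`, so that `q = 0` counts nonzero entries. -/
def absPow (x q : ℝ) : ℝ := if x = 0 then 0 else |x| ^ q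

/-- The sparsity condition
`max_i ∑_j |Σ_ij| ^ q (Σ_ii Σ_jj) ^ ((1 - q) / 2) ≤ b`. -/
def IsSparse {p : ℕ} (q b : ℝ) (S : Matrix (Fin p) (Fin p) ℝ) : Prop :=
  ∀ i, ∑ j, absPow (S i j) q * (S i i * S j j) ^ ((1 - q) / 2) ≤ b

/-- Conditions, at one outcome, on the low-rank part `Θ = ∑_{k ≤ r} λ̄ₖ q̄ₖ q̄ₖᵀ`, on the
idiosyncratic part `S`, and on the scale `M` of the volatility matrix `Θ + S`. -/
structure FactorConditions {p r : ℕ} (C₁ C₂ C₃ c₀ q s M : ℝ)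
    (Θ S : Matrix (Fin p) (Fin p) ℝ)
    (lamBar : Fin r → ℝ) (qBar : Fin r → EuclideanSpace ℝ (Fin p)) : Prop where
  decomposition : IsSpectralDecomposition Θ lamBar qBar
  lamBar_pos : ∀ k, 0 < lamBar k
  symm : S.IsSymm
  M_pos : 0 < M
  sparse : IsSparse q (M * s) S
  spiked : (largestEigenvalue (Θ + S) + p * M) / eigengap lamBar ≤ C₁
  pervasive : C₂ * p ≤ eigengap lamBar
  incoherent : ∀ i, (p : ℝ) / r * ∑ k, (qBar k i) ^ 2 ≤ C₃
  eigenvalue_ge : ∀ μ ∈ spectrum ℝ S, c₀ ≤ μ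

/-- The part `∑_{k ≤ r} λₖ vₖ vₖᵀ` of a spectral decomposition that belongs to the `r` largest
eigenvalues. -/
def principalPart {p : ℕ} (r : ℕ) (lam : Fin p → ℝ)
    (v : Fin p → EuclideanSpace ℝ (Fin p)) : Matrix (Fin p) (Fin p) ℝ :=
  ∑ k : Fin p with k.val < r, lam k • Matrix.vecMulVec (v k).ofLp (v k).ofLp

/-- The adaptive threshold `w √((S_ii ∨ 0) (S_jj ∨ 0))`. -/
def thresholdLevel {p : ℕ} (w : ℝ) (S : Matrix (Fin p) (Fin p) ℝ) (i j : Fin p) : ℝ :=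
  w * √(max (S i i) 0 * max (S j j) 0)

/-- Adaptive thresholding of `S` with threshold functions `t i j`. -/
def thresholded {p : ℕ} (w : ℝ) (t : Fin p → Fin p → ℝ → ℝ)
    (S : Matrix (Fin p) (Fin p) ℝ) : Matrix (Fin p) (Fin p) ℝ :=
  Matrix.of fun i j =>
    if i = j then max (S i i) 0
    else if thresholdLevel w S i j ≤ |S i j| then t i j (S i j) else 0

/-- `max_{i,j} |A_ij|`. -/
def maxNorm {p : ℕ} (A : Matrix (Fin p) (Fin p) ℝ) : ℝ :=
  ⨆ ij : Fin p × Fin p, |A ij.1 ij.2|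

/-- The spectral norm: the operator norm for the Euclidean norm. -/
def specNorm {p : ℕ} (A : Matrix (Fin p) (Fin p) ℝ) : ℝ :=
  ‖Matrix.toEuclideanCLM (n := Fin p) (𝕜 := ℝ) A‖

/-- The Frobenius norm `√(tr (Aᵀ A))`. -/
def frobNorm {p : ℕ} (A : Matrix (Fin p) (Fin p) ℝ) : ℝ :=
  √(Matrix.trace (A.transpose * A))

/-- `G ^ (-1/2)` for a symmetric positive definite matrix, by functional calculus. -/
def invSqrt {p : ℕ} (G : Matrix (Fin p) (Fin p) ℝ) : Matrix (Fin p) (Fin p) ℝ :=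
  cfc (fun x : ℝ => x ^ (-(1 / 2) : ℝ)) G

/-- The relative Frobenius norm: `‖A‖_G ^ 2 = p⁻¹ ‖G ^ (-1/2) A G ^ (-1/2)‖_F ^ 2`. -/
def relFrobNorm {p : ℕ} (G A : Matrix (Fin p) (Fin p) ℝ) : ℝ :=
  √((p : ℝ)⁻¹ * frobNorm (invSqrt G * A * invSqrt G) ^ 2)

end

end POET

/-! Outside two rare events the claim is deterministic. Put E = Γ̂ - Θ, that is, Σ plus the input
error. If the input error is at most C₀τ entrywise, every absolute row sum of E is at most η = (1 +
C₀)pβ, because the sparsity condition bounds the row sums of |Σ| by M s. Hence for small β the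
matrix E is small relative to D ≥ C₂p, both in spectral norm and as an operator on the sup norm.

Low-rank part. Let P̂ be the projection onto the r leading eigenvectors of Γ̂. Then Θ̂ - Θ = P̂E -
(1 - P̂)Θ (`SpikedPerturbation.principalPart_sub_eq`). No eigenvector is matched with another, so
gaps between the λ̄ₖ play no role; only λ̄ᵣ ≥ D is used. Eigenvalue equations read at a largest
coordinate transfer the incoherence of the q̄ₖ (entries of order p^(-1/2)) to the leading q̂ₖ, and
show that (1 - P̂)q̄ₖ has entries of order p^(-1/2) η / D. So Θ̂ - Θ is entrywise of order β
(`SpikedPerturbation.abs_principalPart_sub_le`).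

Sparse part. Now Σ̃ is entrywise within K₁β of Σ. For large C_ϖ the threshold is at least twice this
error, each entry of Σ̂ - Σ is at most a multiple of β^(1-q) times its summand in the sparsity
condition, and the Schur test gives the spectral bound.

Relative norm and inverses. The same identity is multiplied by Γ^(-1/2) or by inverses on both
sides; these contract the leading eigenvectors. Since M s ≥ c₀, stray terms of order β are absorbed
into M s β^(1-q).

Probability. As s²/p → 0, Chebyshev's inequality makes M s / p ≥ ε/2 less likely than 1/p; the input
estimator accounts for the other 1/p. -/

namespace POET

open scoped RealInnerProductSpace

/-! ### Quadratic forms, spectral norm and inverses. -/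

section LinearAlgebra

variable {p : ℕ}

/-- The operator on Euclidean space given by a square matrix. -/
noncomputable abbrev op (A : Matrix (Fin p) (Fin p) ℝ) :
    EuclideanSpace ℝ (Fin p) →L[ℝ] EuclideanSpace ℝ (Fin p) :=
  Matrix.toEuclideanCLM (n := Fin p) (𝕜 := ℝ) A

theorem op_apply (A : Matrix (Fin p) (Fin p) ℝ) (x : EuclideanSpace ℝ (Fin p)) (i : Fin p) :
    op A x i = ∑ j, A i j * x j := by
  rw [Matrix.ofLp_toEuclideanCLM]; rfl

theorem op_vecMulVec (u v x : EuclideanSpace ℝ (Fin p)) :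
    op (Matrix.vecMulVec u.ofLp v.ofLp) x = ⟪v, x⟫ • u := by
  ext i
  rw [op_apply]
  simp only [Matrix.vecMulVec_apply, PiLp.inner_apply, PiLp.smul_apply, smul_eq_mul,
    Finset.sum_mul]
  refine Finset.sum_congr rfl fun j _ => ?_
  simp
  ring

theorem op_mul (A B : Matrix (Fin p) (Fin p) ℝ) (x : EuclideanSpace ℝ (Fin p)) :
    op (A * B) x = op A (op B x) := by
  simp [op, map_mul]

theorem inner_op_comm {A : Matrix (Fin p) (Fin p) ℝ} (hA : A.IsSymm)
    (x y : EuclideanSpace ℝ (Fin p)) : ⟪op A x, y⟫ = ⟪x, op A y⟫ := by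
  simp only [PiLp.inner_apply, op_apply, RCLike.inner_apply, conj_trivial, Finset.sum_mul,
    Finset.mul_sum]
  rw [Finset.sum_comm]
  refine Finset.sum_congr rfl fun j _ => Finset.sum_congr rfl fun i _ => ?_
  rw [← hA.apply]
  ring

theorem norm_op_le (A : Matrix (Fin p) (Fin p) ℝ) (x : EuclideanSpace ℝ (Fin p)) :
    ‖op A x‖ ≤ specNorm A * ‖x‖ :=
  (op A).le_opNorm x

theorem specNorm_le {A : Matrix (Fin p) (Fin p) ℝ} {b : ℝ} (hb : 0 ≤ b)
    (h : ∀ x, ‖op A x‖ ≤ b * ‖x‖) : specNorm A ≤ b :=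
  ContinuousLinearMap.opNorm_le_bound _ hb h

theorem specNorm_nonneg (A : Matrix (Fin p) (Fin p) ℝ) : 0 ≤ specNorm A := norm_nonneg _

theorem specNorm_add_le (A B : Matrix (Fin p) (Fin p) ℝ) :
    specNorm (A + B) ≤ specNorm A + specNorm B := by
  unfold specNorm; rw [map_add]; exact norm_add_le _ _

theorem specNorm_neg (A : Matrix (Fin p) (Fin p) ℝ) : specNorm (-A) = specNorm A := by
  unfold specNorm; rw [map_neg, norm_neg]

theorem specNorm_mul_le (A B : Matrix (Fin p) (Fin p) ℝ) :
    specNorm (A * B) ≤ specNorm A * specNorm B := by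
  unfold specNorm; rw [map_mul]; exact norm_mul_le _ _

/-- The Schur test. -/
theorem specNorm_le_of_sum_le {A : Matrix (Fin p) (Fin p) ℝ} {b : ℝ} (hb : 0 ≤ b)
    (hrow : ∀ i, ∑ j, |A i j| ≤ b) (hcol : ∀ j, ∑ i, |A i j| ≤ b) : specNorm A ≤ b := by
  refine specNorm_le hb fun x => ?_
  refine abs_le_of_sq_le_sq' ?_ (by positivity) |>.2
  rw [EuclideanSpace.norm_sq_eq, mul_pow, EuclideanSpace.norm_sq_eq]
  have key : ∀ i, ‖op A x i‖ ^ 2 ≤ b * ∑ j, |A i j| * ‖x j‖ ^ 2 := by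
    intro i
    rw [op_apply, Real.norm_eq_abs, sq_abs]
    calc (∑ j, A i j * x j) ^ 2 ≤ (∑ j, |A i j|) * ∑ j, |A i j| * ‖x j‖ ^ 2 := by
          refine Finset.sum_sq_le_sum_mul_sum_of_sq_le_mul _ (fun _ _ => abs_nonneg _)
            (fun _ _ => by positivity) fun j _ => le_of_eq ?_
          rw [Real.norm_eq_abs, sq_abs, mul_pow, ← sq_abs (A i j)]; ring
      _ ≤ _ := mul_le_mul_of_nonneg_right (hrow i)
          (Finset.sum_nonneg fun _ _ => by positivity)
  calc ∑ i, ‖op A x i‖ ^ 2 ≤ ∑ i, b * ∑ j, |A i j| * ‖x j‖ ^ 2 :=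
        Finset.sum_le_sum fun i _ => key i
    _ = b * ∑ j, (∑ i, |A i j|) * ‖x j‖ ^ 2 := by
        rw [← Finset.mul_sum, Finset.sum_comm]; simp_rw [Finset.sum_mul]
    _ ≤ b * ∑ j, b * ‖x j‖ ^ 2 :=
        mul_le_mul_of_nonneg_left (Finset.sum_le_sum fun j _ =>
          mul_le_mul_of_nonneg_right (hcol j) (by positivity)) hb
    _ = b ^ 2 * ∑ j, ‖x j‖ ^ 2 := by rw [← Finset.mul_sum]; ring

theorem abs_op_apply_le {A : Matrix (Fin p) (Fin p) ℝ} {b m : ℝ}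
    (hrow : ∀ i, ∑ j, |A i j| ≤ b) {x : EuclideanSpace ℝ (Fin p)} (hx : ∀ j, |x j| ≤ m)
    (hm : 0 ≤ m) (i : Fin p) : |op A x i| ≤ b * m := by
  rw [op_apply]
  calc |∑ j, A i j * x j| ≤ ∑ j, |A i j| * m :=
        (Finset.abs_sum_le_sum_abs _ _).trans (Finset.sum_le_sum fun j _ => by
          rw [abs_mul]; exact mul_le_mul_of_nonneg_left (hx j) (abs_nonneg _))
    _ ≤ b * m := by rw [← Finset.sum_mul]; exact mul_le_mul_of_nonneg_right (hrow i) hm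

theorem inner_op_nonneg_of_posSemidef {A : Matrix (Fin p) (Fin p) ℝ} (hA : A.PosSemidef)
    (x : EuclideanSpace ℝ (Fin p)) : 0 ≤ ⟪x, op A x⟫ := by
  have h := (Matrix.posSemidef_iff_dotProduct_mulVec.1 hA).2 x.ofLp
  rw [EuclideanSpace.inner_eq_star_dotProduct, Matrix.ofLp_toEuclideanCLM, dotProduct_comm]
  exact h

theorem isHermitian_of_isSymm {A : Matrix (Fin p) (Fin p) ℝ} (hA : A.IsSymm) :
    A.IsHermitian := by
  rw [Matrix.IsHermitian, Matrix.conjTranspose_eq_transpose_of_trivial]; exact hA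

theorem op_algebraMap (c : ℝ) (x : EuclideanSpace ℝ (Fin p)) :
    op (algebraMap ℝ (Matrix (Fin p) (Fin p) ℝ) c) x = c • x := by
  rw [op, AlgHomClass.commutes, ContinuousLinearMap.algebraMap_apply]

theorem le_inner_op_of_spectrum {A : Matrix (Fin p) (Fin p) ℝ} (hA : A.IsSymm) {c : ℝ}
    (h : ∀ μ ∈ spectrum ℝ A, c ≤ μ) (x : EuclideanSpace ℝ (Fin p)) :
    c * ‖x‖ ^ 2 ≤ ⟪x, op A x⟫ := by
  have hB : (A - algebraMap ℝ (Matrix (Fin p) (Fin p) ℝ) c).IsHermitian :=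
    (isHermitian_of_isSymm hA).sub (by
      rw [Matrix.algebraMap_eq_diagonal]; exact Matrix.isHermitian_diagonal _)
  have hps : (A - algebraMap ℝ (Matrix (Fin p) (Fin p) ℝ) c).PosSemidef := by
    rw [hB.posSemidef_iff_eigenvalues_nonneg]
    intro i
    have := hB.eigenvalues_mem_spectrum_real i
    rw [← spectrum.sub_singleton_eq] at this
    obtain ⟨a, ha, b, rfl, hab⟩ := Set.mem_sub.1 this
    rw [← hab]; simpa using h a ha
  have := inner_op_nonneg_of_posSemidef hps x
  rw [op, map_sub, _root_.sub_apply, inner_sub_right, ← op, ← op, op_algebraMap,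
    inner_smul_right, real_inner_self_eq_norm_sq] at this
  linarith

theorem inner_op_le_largestEigenvalue {A : Matrix (Fin p) (Fin p) ℝ} (hA : A.IsSymm)
    (x : EuclideanSpace ℝ (Fin p)) : ⟪x, op A x⟫ ≤ largestEigenvalue A * ‖x‖ ^ 2 := by
  have h := le_inner_op_of_spectrum (A := -A) (by simpa using hA.neg)
    (c := -largestEigenvalue A) (fun μ hμ => ?_) x
  · rw [op, map_neg, _root_.neg_apply, inner_neg_right] at h
    linarith
  · rw [← spectrum.neg_eq, Set.mem_neg] at hμ
    have := le_csSup (Matrix.finite_real_spectrum (A := A)).bddAbove hμ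
    unfold largestEigenvalue; linarith

/-- Coercive matrices are invertible. -/
theorem isUnit_of_coercive {A : Matrix (Fin p) (Fin p) ℝ} {c : ℝ} (hc : 0 < c)
    (h : ∀ x, c * ‖x‖ ^ 2 ≤ ⟪x, op A x⟫) : IsUnit A := by
  rw [Matrix.isUnit_iff_isUnit_det, isUnit_iff_ne_zero]
  intro hdet
  obtain ⟨v, hv, hAv⟩ := Matrix.exists_mulVec_eq_zero_iff.2 hdet
  have := h (WithLp.toLp 2 v)
  rw [op, Matrix.toEuclideanCLM_toLp, hAv, WithLp.toLp_zero, inner_zero_right] at this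
  have hv' : (WithLp.toLp 2 v : EuclideanSpace ℝ (Fin p)) ≠ 0 := by simpa using hv
  have := norm_pos_iff.2 hv'
  have : 0 < c * ‖(WithLp.toLp 2 v : EuclideanSpace ℝ (Fin p))‖ ^ 2 := by positivity
  linarith

theorem op_inv_op {A : Matrix (Fin p) (Fin p) ℝ} (hA : IsUnit A)
    (x : EuclideanSpace ℝ (Fin p)) : op A⁻¹ (op A x) = x := by
  rw [← op_mul, Matrix.nonsing_inv_mul _ ((Matrix.isUnit_iff_isUnit_det _).1 hA)]; simp [op]

theorem op_op_inv {A : Matrix (Fin p) (Fin p) ℝ} (hA : IsUnit A)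
    (x : EuclideanSpace ℝ (Fin p)) : op A (op A⁻¹ x) = x := by
  rw [← op_mul, Matrix.mul_nonsing_inv _ ((Matrix.isUnit_iff_isUnit_det _).1 hA)]; simp [op]

theorem norm_op_inv_le {A : Matrix (Fin p) (Fin p) ℝ} {c : ℝ} (hc : 0 < c)
    (h : ∀ x, c * ‖x‖ ^ 2 ≤ ⟪x, op A x⟫) (x : EuclideanSpace ℝ (Fin p)) :
    ‖op A⁻¹ x‖ ≤ c⁻¹ * ‖x‖ := by
  have hA := isUnit_of_coercive hc h
  have h1 := h (op A⁻¹ x)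
  rw [op_op_inv hA] at h1
  have h2 := real_inner_le_norm (op A⁻¹ x) x
  rcases (norm_nonneg (op A⁻¹ x)).eq_or_lt with h0 | h0
  · rw [← h0]; positivity
  · rw [inv_mul_eq_div, le_div_iff₀ hc]
    nlinarith

theorem specNorm_inv_le {A : Matrix (Fin p) (Fin p) ℝ} {c : ℝ} (hc : 0 < c)
    (h : ∀ x, c * ‖x‖ ^ 2 ≤ ⟪x, op A x⟫) : specNorm A⁻¹ ≤ c⁻¹ :=
  specNorm_le (by positivity) (norm_op_inv_le hc h)

/-- For μ < c the matrix A - μ is still coercive, hence invertible. Symmetry is not needed, which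
matters because the thresholded matrix may fail to be symmetric. -/
theorem le_of_mem_spectrum_of_coercive {A : Matrix (Fin p) (Fin p) ℝ} {c : ℝ}
    (h : ∀ x, c * ‖x‖ ^ 2 ≤ ⟪x, op A x⟫) {μ : ℝ} (hμ : μ ∈ spectrum ℝ A) : c ≤ μ := by
  by_contra! hlt
  refine hμ ?_
  have : IsUnit (A - algebraMap ℝ (Matrix (Fin p) (Fin p) ℝ) μ) := by
    refine isUnit_of_coercive (c := c - μ) (by linarith) fun x => ?_
    rw [op, map_sub, _root_.sub_apply, inner_sub_right, ← op, ← op, op_algebraMap,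
      inner_smul_right, real_inner_self_eq_norm_sq]
    linarith [h x]
  rw [spectrum.mem_resolventSet_iff]
  simpa using this.neg

theorem inv_sub_inv_eq {A B : Matrix (Fin p) (Fin p) ℝ} (hA : IsUnit A) (hB : IsUnit B) :
    A⁻¹ - B⁻¹ = -(A⁻¹ * (A - B) * B⁻¹) := by
  have h1 := Matrix.nonsing_inv_mul _ ((Matrix.isUnit_iff_isUnit_det _).1 hA)
  have h2 := Matrix.mul_nonsing_inv _ ((Matrix.isUnit_iff_isUnit_det _).1 hB)
  rw [mul_sub, sub_mul, h1, one_mul, mul_assoc, h2, mul_one, neg_sub]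

theorem specNorm_inv_sub_inv_le {A B : Matrix (Fin p) (Fin p) ℝ} {a b : ℝ} (ha : 0 < a)
    (hb : 0 < b) (hA : ∀ x, a * ‖x‖ ^ 2 ≤ ⟪x, op A x⟫) (hB : ∀ x, b * ‖x‖ ^ 2 ≤ ⟪x, op B x⟫) :
    specNorm (A⁻¹ - B⁻¹) ≤ a⁻¹ * specNorm (A - B) * b⁻¹ := by
  rw [inv_sub_inv_eq (isUnit_of_coercive ha hA) (isUnit_of_coercive hb hB), specNorm_neg]
  refine (specNorm_mul_le _ _).trans ?_
  have h1 := specNorm_inv_le ha hA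
  have h2 := specNorm_inv_le hb hB
  have h3 := specNorm_mul_le A⁻¹ (A - B)
  have h4 := specNorm_nonneg (A - B)
  have h5 := specNorm_nonneg B⁻¹
  have h6 := specNorm_nonneg A⁻¹
  gcongr
  exact h3.trans (by gcongr)

theorem abs_le_maxNorm (A : Matrix (Fin p) (Fin p) ℝ) (i j : Fin p) : |A i j| ≤ maxNorm A :=
  le_ciSup (f := fun ij : Fin p × Fin p => |A ij.1 ij.2|) (Set.finite_range _).bddAbove (i, j)

theorem maxNorm_le {A : Matrix (Fin p) (Fin p) ℝ} {b : ℝ} (hb : 0 ≤ b)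
    (h : ∀ i j, |A i j| ≤ b) : maxNorm A ≤ b :=
  Real.iSup_le (fun ij => h ij.1 ij.2) hb

end LinearAlgebra

/-! ### The Frobenius norm. -/

section Frobenius

open scoped Matrix.Norms.Frobenius

variable {p : ℕ}

theorem frobNorm_sq (A : Matrix (Fin p) (Fin p) ℝ) : frobNorm A ^ 2 = ∑ i, ∑ j, A i j ^ 2 := by
  have h : Matrix.trace (A.transpose * A) = ∑ i, ∑ j, A i j ^ 2 := by
    rw [Finset.sum_comm]
    simp [Matrix.trace, Matrix.mul_apply, sq]
  rw [frobNorm, h, Real.sq_sqrt (Finset.sum_nonneg fun _ _ => Finset.sum_nonneg fun _ _ => by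
    positivity)]

theorem frobNorm_nonneg (A : Matrix (Fin p) (Fin p) ℝ) : 0 ≤ frobNorm A := Real.sqrt_nonneg _

theorem frobNorm_eq_norm (A : Matrix (Fin p) (Fin p) ℝ) : frobNorm A = ‖A‖ := by
  refine (sq_eq_sq₀ (frobNorm_nonneg A) (norm_nonneg A)).1 ?_
  have h0 : 0 ≤ ∑ i, ∑ j, ‖A i j‖ ^ 2 :=
    Finset.sum_nonneg fun _ _ => Finset.sum_nonneg fun _ _ => by positivity
  rw [frobNorm_sq, Matrix.frobenius_norm_def, ← Real.sqrt_eq_rpow]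
  simp_rw [Real.rpow_two] at h0 ⊢
  rw [Real.sq_sqrt h0]
  simp

theorem frobNorm_add_le (A B : Matrix (Fin p) (Fin p) ℝ) :
    frobNorm (A + B) ≤ frobNorm A + frobNorm B := by
  simp_rw [frobNorm_eq_norm]; exact norm_add_le _ _

theorem frobNorm_sub_le (A B : Matrix (Fin p) (Fin p) ℝ) :
    frobNorm (A - B) ≤ frobNorm A + frobNorm B := by
  simp_rw [frobNorm_eq_norm]; exact norm_sub_le _ _

theorem frobNorm_vecMulVec (u v : EuclideanSpace ℝ (Fin p)) :
    frobNorm (Matrix.vecMulVec u.ofLp v.ofLp) = ‖u‖ * ‖v‖ := by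
  refine (sq_eq_sq₀ (frobNorm_nonneg _) (by positivity)).1 ?_
  rw [frobNorm_sq, mul_pow, EuclideanSpace.norm_sq_eq, EuclideanSpace.norm_sq_eq,
    Finset.sum_mul_sum]
  simp [Matrix.vecMulVec_apply, mul_pow]

/-- Since A u vᵀ B = (A u)(B v)ᵀ for symmetric B, a sandwiched sum of r rank-one terms costs no
factor √p, only the lengths of A u and B v. -/
theorem frobNorm_mul_sum_mul_le {ι : Type*} (s : Finset ι) (A : Matrix (Fin p) (Fin p) ℝ)
    {B : Matrix (Fin p) (Fin p) ℝ} (hB : B.IsSymm) (c : ι → ℝ)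
    (u v : ι → EuclideanSpace ℝ (Fin p)) :
    frobNorm (A * (∑ k ∈ s, c k • Matrix.vecMulVec (u k).ofLp (v k).ofLp) * B) ≤
      ∑ k ∈ s, |c k| * (‖op A (u k)‖ * ‖op B (v k)‖) := by
  rw [Finset.mul_sum, Finset.sum_mul, frobNorm_eq_norm]
  refine (norm_sum_le _ _).trans (Finset.sum_le_sum fun k _ => le_of_eq ?_)
  have h : A * Matrix.vecMulVec (u k).ofLp (v k).ofLp * B =
      Matrix.vecMulVec (op A (u k)).ofLp (op B (v k)).ofLp := by
    rw [Matrix.mul_vecMulVec, Matrix.vecMulVec_mul, Matrix.ofLp_toEuclideanCLM,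
      Matrix.ofLp_toEuclideanCLM, ← Matrix.mulVec_transpose, hB.eq]
  rw [mul_smul_comm, smul_mul_assoc, norm_smul, h, ← frobNorm_eq_norm, frobNorm_vecMulVec,
    Real.norm_eq_abs]

theorem specNorm_le_frobNorm (A : Matrix (Fin p) (Fin p) ℝ) : specNorm A ≤ frobNorm A := by
  refine specNorm_le (frobNorm_nonneg A) fun x => ?_
  refine abs_le_of_sq_le_sq' ?_ (mul_nonneg (frobNorm_nonneg A) (norm_nonneg x)) |>.2
  rw [mul_pow, frobNorm_sq, EuclideanSpace.norm_sq_eq, EuclideanSpace.norm_sq_eq,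
    Finset.sum_mul]
  refine Finset.sum_le_sum fun i _ => ?_
  rw [op_apply, Real.norm_eq_abs, sq_abs]
  simp_rw [Real.norm_eq_abs, sq_abs]
  exact Finset.sum_mul_sq_le_sq_mul_sq _ _ _

theorem frobNorm_le_sqrt_mul_specNorm (A : Matrix (Fin p) (Fin p) ℝ) :
    frobNorm A ≤ √p * specNorm A := by
  refine abs_le_of_sq_le_sq' ?_ (mul_nonneg (Real.sqrt_nonneg _) (specNorm_nonneg A)) |>.2
  rw [frobNorm_sq, mul_pow, Real.sq_sqrt (Nat.cast_nonneg _), Finset.sum_comm]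
  calc ∑ j, ∑ i, A i j ^ 2 ≤ ∑ _j : Fin p, specNorm A ^ 2 := by
        refine Finset.sum_le_sum fun j _ => ?_
        have h := norm_op_le A (EuclideanSpace.single j 1)
        rw [PiLp.norm_single, norm_one, mul_one] at h
        have h2 := pow_le_pow_left₀ (norm_nonneg _) h 2
        rw [EuclideanSpace.norm_sq_eq] at h2
        refine le_trans (le_of_eq (Finset.sum_congr rfl fun i _ => ?_)) h2
        rw [op_apply]
        simp
    _ = p * specNorm A ^ 2 := by simp

theorem relFrobNorm_eq (G A : Matrix (Fin p) (Fin p) ℝ) :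
    relFrobNorm G A = (√p)⁻¹ * frobNorm (invSqrt G * A * invSqrt G) := by
  rw [relFrobNorm, Real.sqrt_mul (by positivity), Real.sqrt_sq (frobNorm_nonneg _),
    Real.sqrt_inv]

end Frobenius

/-! ### The inverse square root. -/

section InvSqrt

variable {p : ℕ} {G : Matrix (Fin p) (Fin p) ℝ}

theorem invSqrt_isSymm (G : Matrix (Fin p) (Fin p) ℝ) : (invSqrt G).IsSymm := by
  have h : IsSelfAdjoint (invSqrt G) := cfc_predicate _ G
  rw [IsSelfAdjoint, Matrix.star_eq_conjTranspose,
    Matrix.conjTranspose_eq_transpose_of_trivial] at h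
  exact h

theorem invSqrt_mul_invSqrt (hG : G.IsSymm) {c : ℝ} (hc : 0 < c)
    (h : ∀ x, c * ‖x‖ ^ 2 ≤ ⟪x, op G x⟫) : invSqrt G * invSqrt G = G⁻¹ := by
  have hsa : IsSelfAdjoint G := isHermitian_of_isSymm hG
  have hpos : ∀ μ ∈ spectrum ℝ G, 0 < μ := fun μ hμ =>
    hc.trans_le (le_of_mem_spectrum_of_coercive h hμ)
  have hcont : ContinuousOn (fun x : ℝ => x ^ (-(1 / 2) : ℝ)) (spectrum ℝ G) :=
    continuousOn_id.rpow_const fun x hx => Or.inl (hpos x hx).ne'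
  refine (Matrix.inv_eq_left_inv ?_).symm
  have hid : cfc (fun x : ℝ => x) G = G := cfc_id' ℝ G
  calc invSqrt G * invSqrt G * G
      = cfc (fun x : ℝ => x ^ (-(1 / 2) : ℝ) * x ^ (-(1 / 2) : ℝ) * x) G := by
        rw [cfc_mul (fun x : ℝ => x ^ (-(1 / 2) : ℝ) * x ^ (-(1 / 2) : ℝ)) (fun x => x) G
          (hcont.mul hcont) continuousOn_id, cfc_mul _ _ G hcont hcont, hid]
        rfl
    _ = cfc (fun _ : ℝ => (1 : ℝ)) G := by
        refine cfc_congr fun x hx => ?_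
        have := hpos x hx
        change x ^ (-(1 / 2) : ℝ) * x ^ (-(1 / 2) : ℝ) * x = 1
        rw [← Real.rpow_add this]
        norm_num
        rw [Real.rpow_neg_one, inv_mul_cancel₀ this.ne']
    _ = 1 := cfc_const_one ℝ G

theorem norm_op_invSqrt_sq (hG : G.IsSymm) {c : ℝ} (hc : 0 < c)
    (h : ∀ x, c * ‖x‖ ^ 2 ≤ ⟪x, op G x⟫) (x : EuclideanSpace ℝ (Fin p)) :
    ‖op (invSqrt G) x‖ ^ 2 = ⟪x, op G⁻¹ x⟫ := by
  rw [← invSqrt_mul_invSqrt hG hc h, op_mul, ← inner_op_comm (invSqrt_isSymm G),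
    real_inner_self_eq_norm_sq]

theorem norm_op_invSqrt_le (hG : G.IsSymm) {c : ℝ} (hc : 0 < c)
    (h : ∀ x, c * ‖x‖ ^ 2 ≤ ⟪x, op G x⟫) (x : EuclideanSpace ℝ (Fin p)) :
    ‖op (invSqrt G) x‖ ≤ (√c)⁻¹ * ‖x‖ := by
  refine abs_le_of_sq_le_sq' ?_ (by positivity) |>.2
  rw [norm_op_invSqrt_sq hG hc h, mul_pow, inv_pow, Real.sq_sqrt hc.le]
  have h1 := norm_op_inv_le hc h x
  calc ⟪x, op G⁻¹ x⟫ ≤ ‖x‖ * ‖op G⁻¹ x‖ := real_inner_le_norm _ _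
    _ ≤ ‖x‖ * (c⁻¹ * ‖x‖) := by gcongr
    _ = c⁻¹ * ‖x‖ ^ 2 := by ring

end InvSqrt

/-! ### Spectral decompositions and spectral projections. -/

section Spectral

variable {p m : ℕ} {A : Matrix (Fin p) (Fin p) ℝ} {lam : Fin m → ℝ}
  {v : Fin m → EuclideanSpace ℝ (Fin p)}

theorem IsSpectralDecomposition.op_eq (h : IsSpectralDecomposition A lam v)
    (x : EuclideanSpace ℝ (Fin p)) : op A x = ∑ k, (lam k * ⟪v k, x⟫) • v k := by
  conv_lhs => rw [h.eq_sum]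
  simp only [map_sum, map_smul, _root_.sum_apply, _root_.smul_apply]
  exact Finset.sum_congr rfl fun k _ => by rw [op_vecMulVec, smul_smul]

theorem IsSpectralDecomposition.isSymm (h : IsSpectralDecomposition A lam v) : A.IsSymm := by
  refine Matrix.IsSymm.ext fun i j => ?_
  simp only [h.eq_sum, Matrix.sum_apply, Matrix.smul_apply, Matrix.vecMulVec_apply]
  exact Finset.sum_congr rfl fun k _ => by rw [mul_comm (v k j)]

theorem IsSpectralDecomposition.op_eigenvector (h : IsSpectralDecomposition A lam v)
    (k : Fin m) : op A (v k) = lam k • v k := by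
  rw [h.op_eq, Finset.sum_eq_single k]
  · rw [real_inner_self_eq_norm_sq, h.orthonormal.1 k]; simp
  · intro l _ hl
    rw [h.orthonormal.2 hl]; simp
  · simp

theorem IsSpectralDecomposition.inner_eigenvector_op (h : IsSpectralDecomposition A lam v)
    (k : Fin m) (x : EuclideanSpace ℝ (Fin p)) : ⟪v k, op A x⟫ = lam k * ⟪v k, x⟫ := by
  rw [← inner_op_comm h.isSymm, h.op_eigenvector, real_inner_smul_left]

theorem IsSpectralDecomposition.inner_op_self (h : IsSpectralDecomposition A lam v)
    (x : EuclideanSpace ℝ (Fin p)) : ⟪x, op A x⟫ = ∑ k, lam k * ⟪v k, x⟫ ^ 2 := by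
  rw [h.op_eq, inner_sum]
  refine Finset.sum_congr rfl fun k _ => ?_
  rw [real_inner_smul_right, real_inner_comm x]; ring

theorem sum_inner_smul_of_orthonormal {v : Fin p → EuclideanSpace ℝ (Fin p)}
    (hv : Orthonormal ℝ v) (x : EuclideanSpace ℝ (Fin p)) : ∑ k, ⟪v k, x⟫ • v k = x := by
  rcases Nat.eq_zero_or_pos p with rfl | hp
  · exact Subsingleton.elim _ _
  have : Nonempty (Fin p) := ⟨⟨0, hp⟩⟩
  have hc : Fintype.card (Fin p) = Module.finrank ℝ (EuclideanSpace ℝ (Fin p)) := by simp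
  let b := OrthonormalBasis.mk hv (by
    rw [← coe_basisOfOrthonormalOfCardEqFinrank hv hc]; exact (Module.Basis.span_eq _).ge)
  have := b.sum_repr' x
  simpa [b] using this

theorem sum_inner_sq_of_orthonormal {v : Fin p → EuclideanSpace ℝ (Fin p)}
    (hv : Orthonormal ℝ v) (x : EuclideanSpace ℝ (Fin p)) : ∑ k, ⟪v k, x⟫ ^ 2 = ‖x‖ ^ 2 := by
  rw [← real_inner_self_eq_norm_sq]
  conv_rhs => rw [← sum_inner_smul_of_orthonormal hv x, sum_inner]
  refine Finset.sum_congr rfl fun k _ => ?_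
  rw [real_inner_smul_left, sum_inner_smul_of_orthonormal hv x, sq]

/-- The span of `m` orthonormal vectors meets the orthogonal complement of fewer vectors. -/
theorem exists_ne_zero_orthogonal {V : Type*} [NormedAddCommGroup V] [InnerProductSpace ℝ V]
    {m n : ℕ} (hnm : n < m) {u : Fin m → V} (hu : Orthonormal ℝ u) (v : Fin n → V) :
    ∃ x : V, x ≠ 0 ∧ (∀ y, (∀ l, ⟪u l, y⟫ = 0) → ⟪y, x⟫ = 0) ∧
      ∑ l, ⟪u l, x⟫ ^ 2 = ‖x‖ ^ 2 ∧ ∀ j, ⟪v j, x⟫ = 0 := by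
  -- A combination of the u is sent to its n < m inner products with the v, so f has a nonzero
  -- kernel vector c.
  let f : (Fin m → ℝ) →ₗ[ℝ] (Fin n → ℝ) :=
    { toFun := fun c j => ⟪v j, ∑ l, c l • u l⟫
      map_add' := fun c d => by
        ext j; simp [add_smul, Finset.sum_add_distrib, inner_add_right]
      map_smul' := fun a c => by
        ext j
        simp only [Pi.smul_apply, smul_eq_mul, mul_smul, ← Finset.smul_sum, inner_smul_right,
          RingHom.id_apply] }
  have hker : LinearMap.ker f ≠ ⊥ := LinearMap.ker_ne_bot_of_finrank_lt (by simpa using hnm)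
  obtain ⟨c, hc, hc0⟩ := (Submodule.ne_bot_iff _).1 hker
  have hin : ∀ l, ⟪u l, ∑ l, c l • u l⟫ = c l := fun l => hu.inner_right_fintype c l
  refine ⟨∑ l, c l • u l, fun h0 => hc0 ?_, fun y hy => ?_, ?_, fun j => congrFun hc j⟩
  · ext l
    rw [← hin l, h0, inner_zero_right]; rfl
  · rw [inner_sum]
    refine Finset.sum_eq_zero fun l _ => ?_
    rw [inner_smul_right, real_inner_comm, hy l, mul_zero]
  · rw [← real_inner_self_eq_norm_sq]
    simp_rw [hin]
    rw [sum_inner]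
    refine Finset.sum_congr rfl fun l _ => ?_
    rw [real_inner_smul_left, hin, sq]

/-- The component of `x` orthogonal to the first `r` vectors of `v`. -/
noncomputable def residual (r : ℕ) (v : Fin p → EuclideanSpace ℝ (Fin p))
    (x : EuclideanSpace ℝ (Fin p)) : EuclideanSpace ℝ (Fin p) :=
  x - ∑ l : Fin p with l.val < r, ⟪v l, x⟫ • v l

theorem residual_eq_sum (r : ℕ) {v : Fin p → EuclideanSpace ℝ (Fin p)} (hv : Orthonormal ℝ v)
    (x : EuclideanSpace ℝ (Fin p)) :
    residual r v x = ∑ l : Fin p with ¬ l.val < r, ⟪v l, x⟫ • v l := by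
  rw [residual, sub_eq_iff_eq_add, add_comm, Finset.sum_filter_add_sum_filter_not,
    sum_inner_smul_of_orthonormal hv]

theorem norm_residual_sq (r : ℕ) {v : Fin p → EuclideanSpace ℝ (Fin p)} (hv : Orthonormal ℝ v)
    (x : EuclideanSpace ℝ (Fin p)) :
    ‖residual r v x‖ ^ 2 = ∑ l : Fin p with ¬ l.val < r, ⟪v l, x⟫ ^ 2 := by
  rw [residual_eq_sum r hv, ← real_inner_self_eq_norm_sq, hv.inner_sum]
  simp [sq]

end Spectral

/-- `Γ` is a perturbation, with row sums at most `η`, of a matrix `Θ` of rank `r` whose nonzero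
eigenvalues lie in `[D, L]`. -/
structure SpikedPerturbation {p r : ℕ} (Θ Γ : Matrix (Fin p) (Fin p) ℝ) (lamBar : Fin r → ℝ)
    (qBar : Fin r → EuclideanSpace ℝ (Fin p)) (lamHat : Fin p → ℝ)
    (qHat : Fin p → EuclideanSpace ℝ (Fin p)) (D L η : ℝ) : Prop where
  low : IsSpectralDecomposition Θ lamBar qBar
  full : IsSpectralDecomposition Γ lamHat qHat
  D_pos : 0 < D
  le_lamBar : ∀ k, D ≤ lamBar k
  lamBar_le : ∀ k, lamBar k ≤ L
  L_nonneg : 0 ≤ L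
  row_sum : ∀ i, ∑ j, |(Γ - Θ) i j| ≤ η
  η_nonneg : 0 ≤ η
  small : 4 * η ≤ D

/-! ### Weyl and sin θ bounds, and the identity for the low-rank error. -/

namespace SpikedPerturbation

variable {p r : ℕ} {Θ Γ : Matrix (Fin p) (Fin p) ℝ} {lamBar : Fin r → ℝ}
  {qBar : Fin r → EuclideanSpace ℝ (Fin p)} {lamHat : Fin p → ℝ}
  {qHat : Fin p → EuclideanSpace ℝ (Fin p)} {D L η : ℝ}

theorem symm_sub (h : SpikedPerturbation Θ Γ lamBar qBar lamHat qHat D L η) :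
    (Γ - Θ).IsSymm := h.full.isSymm.sub h.low.isSymm

theorem norm_op_sub_le (h : SpikedPerturbation Θ Γ lamBar qBar lamHat qHat D L η)
    (x : EuclideanSpace ℝ (Fin p)) : ‖op (Γ - Θ) x‖ ≤ η * ‖x‖ := by
  refine (norm_op_le _ _).trans (mul_le_mul_of_nonneg_right ?_ (norm_nonneg _))
  refine specNorm_le_of_sum_le h.η_nonneg h.row_sum fun j => ?_
  refine le_trans (le_of_eq (Finset.sum_congr rfl fun i _ => ?_)) (h.row_sum j)
  rw [h.symm_sub.apply]

theorem op_sub (Θ Γ : Matrix (Fin p) (Fin p) ℝ) (x : EuclideanSpace ℝ (Fin p)) :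
    op (Γ - Θ) x = op Γ x - op Θ x := by
  rw [op, map_sub]; rfl

theorem abs_inner_op_sub_le (h : SpikedPerturbation Θ Γ lamBar qBar lamHat qHat D L η)
    (x : EuclideanSpace ℝ (Fin p)) : |⟪x, op Γ x⟫ - ⟪x, op Θ x⟫| ≤ η * ‖x‖ ^ 2 := by
  rw [← inner_sub_right, ← op_sub]
  calc _ ≤ ‖x‖ * ‖op (Γ - Θ) x‖ := abs_real_inner_le_norm _ _
    _ ≤ ‖x‖ * (η * ‖x‖) := by gcongr; exact h.norm_op_sub_le x
    _ = _ := by ring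

/-- Weyl's inequality by the min-max argument: a vector in the span of all q̄ orthogonal to the q̂
before `k` has Θ-form at least D‖x‖² and Γ-form at most λ̂ₖ‖x‖². -/
theorem le_lamHat (h : SpikedPerturbation Θ Γ lamBar qBar lamHat qHat D L η) {k : Fin p}
    (hk : k.val < r) : D - η ≤ lamHat k := by
  obtain ⟨x, hx0, -, hxs, hxv⟩ := exists_ne_zero_orthogonal hk h.low.orthonormal
    (fun j : Fin k.val => qHat ⟨j, j.2.trans k.2⟩)
  have h1 : ⟪x, op Γ x⟫ ≤ lamHat k * ‖x‖ ^ 2 := by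
    rw [h.full.inner_op_self, ← sum_inner_sq_of_orthonormal h.full.orthonormal, Finset.mul_sum]
    refine Finset.sum_le_sum fun j _ => ?_
    rcases lt_or_ge j k with hj | hj
    · have : ⟪qHat j, x⟫ = 0 := hxv ⟨j, hj⟩
      rw [this]; simp
    · exact mul_le_mul_of_nonneg_right (h.full.antitone hj) (sq_nonneg _)
  have h2 : D * ‖x‖ ^ 2 ≤ ⟪x, op Θ x⟫ := by
    rw [h.low.inner_op_self, ← hxs, Finset.mul_sum]
    exact Finset.sum_le_sum fun j _ => mul_le_mul_of_nonneg_right (h.le_lamBar j) (sq_nonneg _)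
  have h3 := (abs_le.1 (h.abs_inner_op_sub_le x)).1
  have h4 : 0 < ‖x‖ ^ 2 := by have := norm_pos_iff.2 hx0; positivity
  refine le_of_mul_le_mul_right ?_ h4
  linarith

/-- The dual argument: the span of the q̂ up to and including `k` has dimension above r, so it
contains a nonzero vector on which the form of Θ vanishes. -/
theorem lamHat_le (h : SpikedPerturbation Θ Γ lamBar qBar lamHat qHat D L η) {k : Fin p}
    (hk : ¬ k.val < r) : lamHat k ≤ η := by
  obtain ⟨x, hx0, hxu, hxs, hxv⟩ := exists_ne_zero_orthogonal (m := k.val + 1) (n := r)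
    (by omega) (u := fun j : Fin (k.val + 1) => qHat ⟨j, by have := k.2; omega⟩)
    (h.full.orthonormal.comp _ fun a b hab => by
      simpa [Fin.ext_iff] using hab) qBar
  have h1 : lamHat k * ‖x‖ ^ 2 ≤ ⟪x, op Γ x⟫ := by
    rw [h.full.inner_op_self, ← sum_inner_sq_of_orthonormal h.full.orthonormal, Finset.mul_sum]
    refine Finset.sum_le_sum fun j _ => ?_
    rcases le_or_gt j k with hj | hj
    · exact mul_le_mul_of_nonneg_right (h.full.antitone hj) (sq_nonneg _)
    · have : ⟪qHat j, x⟫ = 0 := by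
        refine hxu _ fun l => h.full.orthonormal.2 fun hl => ?_
        have h1 := l.2
        have h2 : l.val = j.val := congrArg Fin.val hl
        have h3 : k.val < j.val := hj
        omega
      rw [this]; simp
  have h2 : ⟪x, op Θ x⟫ = 0 := by
    rw [h.low.inner_op_self]
    exact Finset.sum_eq_zero fun j _ => by rw [hxv j]; simp
  have h3 := (abs_le.1 (h.abs_inner_op_sub_le x)).2
  have h4 : 0 < ‖x‖ ^ 2 := by have := norm_pos_iff.2 hx0; positivity
  refine le_of_mul_le_mul_right ?_ h4
  linarith

theorem norm_qBar (h : SpikedPerturbation Θ Γ lamBar qBar lamHat qHat D L η) (k : Fin r) :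
    ‖qBar k‖ = 1 := h.low.orthonormal.1 k

theorem norm_qHat (h : SpikedPerturbation Θ Γ lamBar qBar lamHat qHat D L η) (k : Fin p) :
    ‖qHat k‖ = 1 := h.full.orthonormal.1 k

/-- A `sin θ` bound. -/
theorem norm_residual_le (h : SpikedPerturbation Θ Γ lamBar qBar lamHat qHat D L η)
    (k : Fin r) : ‖residual r qHat (qBar k)‖ ≤ 2 * η / D := by
  have hD := h.D_pos
  have hη := h.η_nonneg
  refine abs_le_of_sq_le_sq' ?_ (by positivity) |>.2
  rw [norm_residual_sq r h.full.orthonormal]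
  have hl := h.le_lamBar k
  have hs := h.small
  -- Pairing (Γ - Θ)q̄ₖ with q̂ₗ gives (λ̂ₗ - λ̄ₖ)⟨q̂ₗ, q̄ₖ⟩, and for trailing l the gap is at least
  -- D - η ≥ D/2.
  have key : ∀ l : Fin p, ¬ l.val < r →
      ⟪qHat l, qBar k⟫ ^ 2 ≤ (2 / D) ^ 2 * ⟪qHat l, op (Γ - Θ) (qBar k)⟫ ^ 2 := by
    intro l hlr
    have h1 : ⟪qHat l, op (Γ - Θ) (qBar k)⟫ = -((lamBar k - lamHat l) * ⟪qHat l, qBar k⟫) := by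
      rw [op_sub, inner_sub_right, h.full.inner_eigenvector_op, h.low.op_eigenvector,
        inner_smul_right]
      ring
    have h2 : D / 2 ≤ lamBar k - lamHat l := by have := h.lamHat_le hlr; linarith
    have h4 : 1 ≤ (2 / D) ^ 2 * (lamBar k - lamHat l) ^ 2 := by
      rw [← mul_pow]
      refine one_le_pow₀ ?_
      calc (1 : ℝ) = 2 / D * (D / 2) := by field_simp
        _ ≤ _ := by gcongr
    rw [h1, neg_sq, mul_pow, ← mul_assoc]
    exact le_mul_of_one_le_left (sq_nonneg _) h4
  calc ∑ l : Fin p with ¬ l.val < r, ⟪qHat l, qBar k⟫ ^ 2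
      ≤ ∑ l : Fin p with ¬ l.val < r, (2 / D) ^ 2 * ⟪qHat l, op (Γ - Θ) (qBar k)⟫ ^ 2 :=
        Finset.sum_le_sum fun l hl => key l (by simpa using hl)
    _ ≤ ∑ l : Fin p, (2 / D) ^ 2 * ⟪qHat l, op (Γ - Θ) (qBar k)⟫ ^ 2 :=
        Finset.sum_le_sum_of_subset_of_nonneg (Finset.filter_subset _ _)
          fun _ _ _ => by positivity
    _ = (2 / D) ^ 2 * ‖op (Γ - Θ) (qBar k)‖ ^ 2 := by
        rw [← Finset.mul_sum, sum_inner_sq_of_orthonormal h.full.orthonormal]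
    _ ≤ (2 / D) ^ 2 * η ^ 2 := by
        have := h.norm_op_sub_le (qBar k)
        rw [h.norm_qBar, mul_one] at this
        gcongr
    _ = (2 * η / D) ^ 2 := by ring

theorem card_filter_le (p r : ℕ) :
    ((Finset.univ.filter fun l : Fin p => l.val < r).card : ℝ) ≤ r := by
  have : (Finset.univ.filter fun l : Fin p => l.val < r).card ≤ (Finset.range r).card :=
    Finset.card_le_card_of_injOn (fun l => l.val) (fun l hl => by simpa using hl)
      fun a _ b _ hab => Fin.ext hab
  rw [Finset.card_range] at this
  exact_mod_cast this

/-- With P the projection onto the leading q̂, the principal part is PΓ, so the difference is P(Γ -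
Θ) - (1 - P)Θ. The coefficient 1 gives both sums the shape required by `frobNorm_mul_sum_mul_le`. -/
theorem principalPart_sub_eq (h : SpikedPerturbation Θ Γ lamBar qBar lamHat qHat D L η) :
    principalPart r lamHat qHat - Θ =
      ∑ k : Fin p with k.val < r,
        (1 : ℝ) • Matrix.vecMulVec (qHat k).ofLp (op (Γ - Θ) (qHat k)).ofLp -
      ∑ k, lamBar k • Matrix.vecMulVec (residual r qHat (qBar k)).ofLp (qBar k).ofLp := by
  ext i j
  have hΘ : Θ i j = ∑ k, lamBar k * (qBar k i * qBar k j) := by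
    conv_lhs => rw [h.low.eq_sum]
    simp [Matrix.sum_apply, Matrix.vecMulVec_apply]
  have hE : ∀ k, (op (Γ - Θ) (qHat k)) j =
      lamHat k * qHat k j - ∑ l, lamBar l * ⟪qHat k, qBar l⟫ * qBar l j := by
    intro k
    rw [op_sub, h.full.op_eigenvector, h.low.op_eq]
    simp [PiLp.sub_apply, real_inner_comm]
  simp only [principalPart, Matrix.sub_apply, Matrix.sum_apply, Matrix.smul_apply,
    Matrix.vecMulVec_apply, smul_eq_mul, one_mul, hE, hΘ, residual, PiLp.sub_apply,
    WithLp.ofLp_sum, Finset.sum_apply, PiLp.smul_apply]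
  simp only [mul_sub, sub_mul, Finset.sum_sub_distrib, Finset.mul_sum, Finset.sum_mul]
  rw [Finset.sum_comm (s := Finset.univ.filter _)]
  have e1 : ∀ k, lamHat k * (qHat k i * qHat k j) = qHat k i * (lamHat k * qHat k j) :=
    fun k => by ring
  have e2 : ∀ (k : Fin p) (l : Fin r),
      qHat k i * (lamBar l * ⟪qHat k, qBar l⟫ * qBar l j) =
      lamBar l * (⟪qHat k, qBar l⟫ * qHat k i * qBar l j) := fun k l => by ring
  simp only [e1, e2]
  ring

end SpikedPerturbation

theorem residual_add_smul {p : ℕ} (r : ℕ) (v : Fin p → EuclideanSpace ℝ (Fin p)) (a : ℝ)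
    (x y : EuclideanSpace ℝ (Fin p)) :
    residual r v (a • x + y) = a • residual r v x + residual r v y := by
  simp only [residual, inner_add_right, inner_smul_right, add_smul, Finset.sum_add_distrib,
    smul_sub, Finset.smul_sum, smul_smul]
  abel

theorem IsSpectralDecomposition.op_residual {p : ℕ} {A : Matrix (Fin p) (Fin p) ℝ}
    {lam : Fin p → ℝ} {v : Fin p → EuclideanSpace ℝ (Fin p)}
    (h : IsSpectralDecomposition A lam v) (r : ℕ) (x : EuclideanSpace ℝ (Fin p)) :
    op A (residual r v x) = residual r v (op A x) := by
  rw [residual_eq_sum r h.orthonormal, residual_eq_sum r h.orthonormal, map_sum]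
  refine Finset.sum_congr rfl fun l _ => ?_
  rw [map_smul, h.op_eigenvector, h.inner_eigenvector_op, smul_smul, mul_comm]

theorem abs_inner_le_of_norm_eq_one {V : Type*} [NormedAddCommGroup V] [InnerProductSpace ℝ V]
    {u x : V} (hu : ‖u‖ = 1) : |⟪u, x⟫| ≤ ‖x‖ := by
  simpa [hu] using abs_real_inner_le_norm u x

theorem op_principalPart {p : ℕ} (r : ℕ) (lam : Fin p → ℝ)
    (v : Fin p → EuclideanSpace ℝ (Fin p)) (x : EuclideanSpace ℝ (Fin p)) :
    op (principalPart r lam v) x = ∑ k : Fin p with k.val < r, (lam k * ⟪v k, x⟫) • v k := by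
  simp only [principalPart, map_sum, map_smul, _root_.sum_apply, _root_.smul_apply]
  exact Finset.sum_congr rfl fun k _ => by rw [op_vecMulVec, smul_smul]

theorem op_principalPart_eigenvector {p : ℕ} {r : ℕ} (lam : Fin p → ℝ)
    {v : Fin p → EuclideanSpace ℝ (Fin p)} (hv : Orthonormal ℝ v) {k : Fin p}
    (hk : k.val < r) : op (principalPart r lam v) (v k) = lam k • v k := by
  rw [op_principalPart, Finset.sum_eq_single k]
  · rw [real_inner_self_eq_norm_sq, hv.1 k]; simp
  · intro l _ hl
    rw [hv.2 hl]; simp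
  · simp [hk]

theorem mul_le_sq_mul {a b : ℝ} (ha : 1 ≤ a) (hb : 1 ≤ b) : a * b ≤ a ^ 2 * b :=
  mul_le_mul_of_nonneg_right (by nlinarith) (by linarith)

theorem le_sq_mul {a b : ℝ} (ha : 1 ≤ a) (hb : 1 ≤ b) : a ≤ a ^ 2 * b := by
  have := mul_le_sq_mul ha hb
  nlinarith

/-- An approximate eigenvector of a coercive matrix is contracted by the inverse. -/
theorem norm_op_inv_eigenvector_le {p : ℕ} {X Y Z : Matrix (Fin p) (Fin p) ℝ} (hX : X = Y + Z)
    {a b l : ℝ} (ha : 0 < a) (hl : 0 < l) (hc : ∀ x, a * ‖x‖ ^ 2 ≤ ⟪x, op X x⟫)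
    {u : EuclideanSpace ℝ (Fin p)} {lam : ℝ} (hY : op Y u = lam • u) (hlam : l ≤ lam)
    (hu : ‖u‖ = 1) (hZ : specNorm Z ≤ b) : ‖op X⁻¹ u‖ ≤ (1 + a⁻¹ * b) / l := by
  have hU := isUnit_of_coercive ha hc
  have hlam0 : 0 < lam := hl.trans_le hlam
  have e1 : op X u = lam • u + op Z u := by
    rw [hX, op, map_add, _root_.add_apply, ← op, ← op, hY]
  -- Obtained by applying X⁻¹ to X u = λu + Z u.
  have e2 : lam • op X⁻¹ u = u - op X⁻¹ (op Z u) := by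
    rw [eq_sub_iff_add_eq, ← map_smul, ← map_add, ← e1, op_inv_op hU]
  have e3 : lam * ‖op X⁻¹ u‖ ≤ 1 + a⁻¹ * b := by
    calc lam * ‖op X⁻¹ u‖ = ‖lam • op X⁻¹ u‖ := by
          rw [norm_smul, Real.norm_of_nonneg hlam0.le]
      _ ≤ ‖u‖ + ‖op X⁻¹ (op Z u)‖ := by rw [e2]; exact norm_sub_le _ _
      _ ≤ 1 + a⁻¹ * b := by
          rw [hu]
          gcongr
          refine (norm_op_inv_le ha hc _).trans ?_
          gcongr
          refine (norm_op_le Z u).trans ?_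
          rw [hu, mul_one]; exact hZ
  rw [le_div_iff₀ hl]
  nlinarith [norm_nonneg (op X⁻¹ u)]

/-! ### Entrywise, relative and inverse error bounds for the low-rank part. -/

namespace SpikedPerturbation

variable {p r : ℕ} {Θ Γ : Matrix (Fin p) (Fin p) ℝ} {lamBar : Fin r → ℝ}
  {qBar : Fin r → EuclideanSpace ℝ (Fin p)} {lamHat : Fin p → ℝ}
  {qHat : Fin p → EuclideanSpace ℝ (Fin p)} {D K η κ : ℝ}

theorem abs_op_low_apply_le (h : SpikedPerturbation Θ Γ lamBar qBar lamHat qHat D (K * D) η)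
    (hq : ∀ k i, |qBar k i| ≤ κ) (x : EuclideanSpace ℝ (Fin p)) (i : Fin p) :
    |op Θ x i| ≤ r * (K * D * ‖x‖ * κ) := by
  rw [h.low.op_eq]
  simp only [WithLp.ofLp_sum, Finset.sum_apply, PiLp.smul_apply, smul_eq_mul]
  refine (Finset.abs_sum_le_sum_abs _ _).trans ?_
  calc ∑ k, |lamBar k * ⟪qBar k, x⟫ * qBar k i| ≤ ∑ _k : Fin r, K * D * ‖x‖ * κ := by
        refine Finset.sum_le_sum fun k _ => ?_
        rw [abs_mul, abs_mul, abs_of_pos (h.D_pos.trans_le (h.le_lamBar k))]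
        have h1 := h.lamBar_le k
        have h2 := abs_inner_le_of_norm_eq_one (x := x) (h.norm_qBar k)
        have h3 := hq k i
        have h4 := h.L_nonneg
        gcongr
    _ = _ := by simp

/-- In λ̂q̂ = Θq̂ + (Γ - Θ)q̂, read at a largest coordinate m, the last term is at most η|q̂ₘ| and
is absorbed because λ̂ - η ≥ D/2; the entries of Θq̂ inherit the incoherence of the q̄. -/
theorem abs_qHat_le (h : SpikedPerturbation Θ Γ lamBar qBar lamHat qHat D (K * D) η)
    (hq : ∀ k i, |qBar k i| ≤ κ) {k : Fin p} (hk : k.val < r) (i : Fin p) :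
    |qHat k i| ≤ 2 * (r * K * κ) := by
  have : Nonempty (Fin p) := ⟨i⟩
  obtain ⟨m, hm⟩ := Finite.exists_max fun i => |qHat k i|
  refine (hm i).trans ?_
  have h1 : lamHat k • qHat k = op Θ (qHat k) + op (Γ - Θ) (qHat k) := by
    rw [op_sub, ← h.full.op_eigenvector]; abel
  have h2 : lamHat k * qHat k m = op Θ (qHat k) m + op (Γ - Θ) (qHat k) m := by
    simpa using congrArg (fun x : EuclideanSpace ℝ (Fin p) => x m) h1
  have h3 := h.abs_op_low_apply_le hq (qHat k) m
  have h4 := abs_op_apply_le h.row_sum hm (abs_nonneg _) m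
  have h5 := h.le_lamHat hk
  have h6 : lamHat k * |qHat k m| ≤ r * (K * D * ‖qHat k‖ * κ) + η * |qHat k m| := by
    have h7 : 0 ≤ lamHat k := by linarith [h.small, h.D_pos, h.η_nonneg]
    calc lamHat k * |qHat k m| = |lamHat k * qHat k m| := by rw [abs_mul, abs_of_nonneg h7]
      _ ≤ _ := by rw [h2]; exact (abs_add_le _ _).trans (add_le_add h3 h4)
  rw [h.norm_qHat] at h6
  have h8 : D / 2 * |qHat k m| ≤ D / 2 * (2 * (r * K * κ)) := by
    have := mul_le_mul_of_nonneg_right (show D / 2 ≤ lamHat k - η by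
      linarith [h.small, h.η_nonneg]) (abs_nonneg (qHat k m))
    nlinarith
  exact le_of_mul_le_mul_left h8 (by linarith [h.D_pos])

/-- The complementary spectral projection commutes with Γ, so the residual of q̄ₖ satisfies an
eigenvalue equation with a forcing term, open to the same argument as for q̂. -/
theorem lamBar_smul_residual (h : SpikedPerturbation Θ Γ lamBar qBar lamHat qHat D (K * D) η)
    (k : Fin r) : lamBar k • residual r qHat (qBar k) =
      op Θ (residual r qHat (qBar k)) + op (Γ - Θ) (residual r qHat (qBar k)) -
        residual r qHat (op (Γ - Θ) (qBar k)) := by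
  have h1 : op Γ (qBar k) = lamBar k • qBar k + op (Γ - Θ) (qBar k) := by
    rw [op_sub, h.low.op_eigenvector]; abel
  rw [op_sub Θ Γ (residual _ _ _), h.full.op_residual, h1, residual_add_smul]
  abel

theorem abs_residual_op_apply_le
    (h : SpikedPerturbation Θ Γ lamBar qBar lamHat qHat D (K * D) η)
    (hq : ∀ k i, |qBar k i| ≤ κ) (hκ : 0 ≤ κ) (k : Fin r) (i : Fin p) :
    |residual r qHat (op (Γ - Θ) (qBar k)) i| ≤ η * κ + r * (η * (2 * (r * K * κ))) := by
  simp only [residual, PiLp.sub_apply, WithLp.ofLp_sum, Finset.sum_apply, PiLp.smul_apply,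
    smul_eq_mul]
  refine (abs_sub _ _).trans (add_le_add (abs_op_apply_le h.row_sum (hq k) hκ i) ?_)
  have hη := h.η_nonneg
  have hD := h.D_pos
  have hK : 0 ≤ K := nonneg_of_mul_nonneg_left h.L_nonneg hD
  calc _ ≤ ∑ l : Fin p with l.val < r, η * (2 * (r * K * κ)) := by
        refine (Finset.abs_sum_le_sum_abs _ _).trans (Finset.sum_le_sum fun l hl => ?_)
        rw [abs_mul]
        have h1 := abs_inner_le_of_norm_eq_one (x := op (Γ - Θ) (qBar k)) (h.norm_qHat l)
        have h2 := h.norm_op_sub_le (qBar k)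
        rw [h.norm_qBar, mul_one] at h2
        have h3 := h.abs_qHat_le hq (k := l) (by simpa using hl) i
        exact mul_le_mul (h1.trans h2) h3 (abs_nonneg _) hη
    _ ≤ r * (η * (2 * (r * K * κ))) := by
        rw [Finset.sum_const, nsmul_eq_mul]
        exact mul_le_mul_of_nonneg_right (card_filter_le p r) (by positivity)

/-- Absorption at a largest coordinate again; here Θw is small because the sin θ bound makes w
short. -/
theorem abs_residual_le (h : SpikedPerturbation Θ Γ lamBar qBar lamHat qHat D (K * D) η)
    (hq : ∀ k i, |qBar k i| ≤ κ) (hκ : 0 ≤ κ) (hK : 1 ≤ K) (k : Fin r) (i : Fin p) :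
    |residual r qHat (qBar k) i| ≤ 10 * (r ^ 2 * K * κ * (η / D)) := by
  have : Nonempty (Fin p) := ⟨i⟩
  set w := residual r qHat (qBar k) with hw
  obtain ⟨m, hm⟩ := Finite.exists_max fun i => |w i|
  refine (hm i).trans ?_
  have hr : (1 : ℝ) ≤ r := by exact_mod_cast (show 1 ≤ r by have := k.2; omega)
  have hη := h.η_nonneg
  have hD := h.D_pos
  have h1 : lamBar k * w m = op Θ w m + op (Γ - Θ) w m -
      residual r qHat (op (Γ - Θ) (qBar k)) m := by
    simpa using congrArg (fun x : EuclideanSpace ℝ (Fin p) => x m) (h.lamBar_smul_residual k)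
  have h2 : |op Θ w m| ≤ r * (K * D * (2 * η / D) * κ) := by
    refine (h.abs_op_low_apply_le hq w m).trans ?_
    have := h.norm_residual_le k
    gcongr
  have h3 := abs_op_apply_le h.row_sum hm (abs_nonneg _) m
  have h4 := h.abs_residual_op_apply_le hq hκ k m
  have h5 : lamBar k * |w m| ≤ r * (K * D * (2 * η / D) * κ) + η * |w m| +
      (η * κ + r * (η * (2 * (r * K * κ)))) := by
    calc lamBar k * |w m| = |lamBar k * w m| := by
          rw [abs_mul, abs_of_pos (hD.trans_le (h.le_lamBar k))]
      _ ≤ _ := by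
          rw [h1]
          exact (abs_sub _ _).trans (add_le_add ((abs_add_le _ _).trans (add_le_add h2 h3)) h4)
  have e1 : r * (K * D * (2 * η / D) * κ) = 2 * (r * K) * (η * κ) := by field_simp
  rw [e1] at h5
  have h6 : D / 2 * |w m| ≤ (lamBar k - η) * |w m| :=
    mul_le_mul_of_nonneg_right (by linarith [h.small, h.le_lamBar k]) (abs_nonneg _)
  have h7 : 2 * (r * K) + 1 + 2 * (r ^ 2 * K) ≤ 5 * (r ^ 2 * K) := by
    linarith [mul_le_sq_mul hr hK, le_sq_mul hr hK]
  have h8 : D / 2 * |w m| ≤ D / 2 * (10 * (r ^ 2 * K * κ * (η / D))) := by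
    have e2 : D / 2 * (10 * (r ^ 2 * K * κ * (η / D))) = 5 * (r ^ 2 * K) * (η * κ) := by
      field_simp; ring
    rw [e2]
    have := mul_le_mul_of_nonneg_right h7 (mul_nonneg hη hκ)
    linarith
  exact le_of_mul_le_mul_left h8 (by linarith)

/-- In both sums of `principalPart_sub_eq` one factor has entries of order κ and the other, with its
weight λ̄ₖ in the second sum, of order κη. With κ² of order 1/p and η of order pβ this is of order
β. -/
theorem abs_principalPart_sub_le
    (h : SpikedPerturbation Θ Γ lamBar qBar lamHat qHat D (K * D) η)
    (hq : ∀ k i, |qBar k i| ≤ κ) (hκ : 0 ≤ κ) (hK : 1 ≤ K) (i j : Fin p) :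
    |(principalPart r lamHat qHat - Θ) i j| ≤ 14 * (r ^ 3 * K ^ 2 * κ ^ 2 * η) := by
  have hη := h.η_nonneg
  have hD := h.D_pos
  rw [h.principalPart_sub_eq]
  simp only [Matrix.sub_apply, Matrix.sum_apply, Matrix.smul_apply, Matrix.vecMulVec_apply,
    smul_eq_mul, one_mul]
  have h1 : |∑ k : Fin p with k.val < r, qHat k i * op (Γ - Θ) (qHat k) j| ≤
      r * (2 * (r * K * κ) * (η * (2 * (r * K * κ)))) := by
    calc _ ≤ ∑ k : Fin p with k.val < r, 2 * (r * K * κ) * (η * (2 * (r * K * κ))) := by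
          refine (Finset.abs_sum_le_sum_abs _ _).trans (Finset.sum_le_sum fun k hk => ?_)
          have hk' : k.val < r := by simpa using hk
          rw [abs_mul]
          exact mul_le_mul (h.abs_qHat_le hq hk' i)
            (abs_op_apply_le h.row_sum (h.abs_qHat_le hq hk') (by positivity) j)
            (abs_nonneg _) (by positivity)
      _ ≤ _ := by
          rw [Finset.sum_const, nsmul_eq_mul]
          exact mul_le_mul_of_nonneg_right (card_filter_le p r) (by positivity)
  have h2 : |∑ k, lamBar k * (residual r qHat (qBar k) i * qBar k j)| ≤
      r * (K * D * (10 * (r ^ 2 * K * κ * (η / D)) * κ)) := by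
    calc _ ≤ ∑ _k : Fin r, K * D * (10 * (r ^ 2 * K * κ * (η / D)) * κ) := by
          refine (Finset.abs_sum_le_sum_abs _ _).trans (Finset.sum_le_sum fun k _ => ?_)
          rw [abs_mul, abs_mul, abs_of_pos (hD.trans_le (h.le_lamBar k))]
          have h3 := h.lamBar_le k
          have h4 := h.abs_residual_le hq hκ hK k i
          have h5 := hq k j
          gcongr
      _ = _ := by simp
  refine (abs_sub _ _).trans ((add_le_add h1 h2).trans (le_of_eq ?_))
  field_simp
  ring

/-- Only the right factor has to be symmetric: for the inverses, the left one is the inverse of the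
estimator, which need not be. -/
theorem frobNorm_mul_principalPart_sub_mul_le
    (h : SpikedPerturbation Θ Γ lamBar qBar lamHat qHat D (K * D) η)
    (A : Matrix (Fin p) (Fin p) ℝ) {B : Matrix (Fin p) (Fin p) ℝ} (hB : B.IsSymm)
    {a b a' b' : ℝ} (ha0 : 0 ≤ a) (hb0 : 0 ≤ b) (ha0' : 0 ≤ a')
    (ha : ∀ k : Fin p, k.val < r → ‖op A (qHat k)‖ ≤ a)
    (hb : ∀ k : Fin p, ‖op B (op (Γ - Θ) (qHat k))‖ ≤ b)
    (ha' : ∀ k, ‖op A (residual r qHat (qBar k))‖ ≤ a') (hb' : ∀ k, ‖op B (qBar k)‖ ≤ b') :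
    frobNorm (A * (principalPart r lamHat qHat - Θ) * B) ≤
      r * (a * b) + r * (K * D * (a' * b')) := by
  rw [h.principalPart_sub_eq, mul_sub, sub_mul]
  refine (frobNorm_sub_le _ _).trans (add_le_add ?_ ?_)
  · refine (frobNorm_mul_sum_mul_le _ A hB _ _ _).trans ?_
    calc _ ≤ ∑ k : Fin p with k.val < r, a * b := by
          refine Finset.sum_le_sum fun k hk => ?_
          rw [abs_one, one_mul]
          exact mul_le_mul (ha k (by simpa using hk)) (hb k) (norm_nonneg _) ha0
      _ ≤ _ := by
          rw [Finset.sum_const, nsmul_eq_mul]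
          exact mul_le_mul_of_nonneg_right (card_filter_le p r) (by positivity)
  · refine (frobNorm_mul_sum_mul_le _ A hB _ _ _).trans ?_
    calc _ ≤ ∑ _k : Fin r, K * D * (a' * b') := by
          refine Finset.sum_le_sum fun k _ => ?_
          rw [abs_of_pos (h.D_pos.trans_le (h.le_lamBar k))]
          exact mul_le_mul (h.lamBar_le k)
            (mul_le_mul (ha' k) (hb' k) (norm_nonneg _) ha0') (by positivity) h.L_nonneg
      _ = _ := by simp

variable {S : Matrix (Fin p) (Fin p) ℝ} {c : ℝ}

theorem inner_op_low_ge (h : SpikedPerturbation Θ Γ lamBar qBar lamHat qHat D (K * D) η)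
    (k : Fin r) (x : EuclideanSpace ℝ (Fin p)) : lamBar k * ⟪qBar k, x⟫ ^ 2 ≤ ⟪x, op Θ x⟫ := by
  rw [h.low.inner_op_self]
  exact Finset.single_le_sum (f := fun k => lamBar k * ⟪qBar k, x⟫ ^ 2)
    (fun l _ => mul_nonneg (h.D_pos.le.trans (h.le_lamBar l)) (sq_nonneg _)) (Finset.mem_univ k)

theorem inner_op_low_nonneg (h : SpikedPerturbation Θ Γ lamBar qBar lamHat qHat D (K * D) η)
    (x : EuclideanSpace ℝ (Fin p)) : 0 ≤ ⟪x, op Θ x⟫ := by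
  rw [h.low.inner_op_self]
  exact Finset.sum_nonneg fun l _ =>
    mul_nonneg (h.D_pos.le.trans (h.le_lamBar l)) (sq_nonneg _)

theorem inner_op_principalPart_nonneg
    (h : SpikedPerturbation Θ Γ lamBar qBar lamHat qHat D (K * D) η)
    (x : EuclideanSpace ℝ (Fin p)) : 0 ≤ ⟪x, op (principalPart r lamHat qHat) x⟫ := by
  rw [op_principalPart, inner_sum]
  refine Finset.sum_nonneg fun k hk => ?_
  have := h.le_lamHat (k := k) (by simpa using hk)
  rw [inner_smul_right, real_inner_comm x, mul_assoc]
  exact mul_nonneg (by linarith [h.small, h.η_nonneg, h.D_pos]) (mul_self_nonneg _)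

theorem inner_op_add {A B : Matrix (Fin p) (Fin p) ℝ} (x : EuclideanSpace ℝ (Fin p)) :
    ⟪x, op (A + B) x⟫ = ⟪x, op A x⟫ + ⟪x, op B x⟫ := by
  rw [op, map_add, _root_.add_apply, inner_add_right]

theorem coercive_add (h : SpikedPerturbation Θ Γ lamBar qBar lamHat qHat D (K * D) η)
    (hS : ∀ x, c * ‖x‖ ^ 2 ≤ ⟪x, op S x⟫) (x : EuclideanSpace ℝ (Fin p)) :
    c * ‖x‖ ^ 2 ≤ ⟪x, op (Θ + S) x⟫ := by
  rw [inner_op_add]; linarith [hS x, h.inner_op_low_nonneg x]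

theorem coercive_principalPart_add
    (h : SpikedPerturbation Θ Γ lamBar qBar lamHat qHat D (K * D) η)
    (hS : ∀ x, c * ‖x‖ ^ 2 ≤ ⟪x, op S x⟫) (x : EuclideanSpace ℝ (Fin p)) :
    c * ‖x‖ ^ 2 ≤ ⟪x, op (principalPart r lamHat qHat + S) x⟫ := by
  rw [inner_op_add]; linarith [hS x, h.inner_op_principalPart_nonneg x]

/-- The squared length is z = ⟨q̄ₖ, (Θ + S)⁻¹q̄ₖ⟩. Since Θ + S dominates λ̄ₖq̄ₖq̄ₖᵀ, testing on (Θ +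
S)⁻¹q̄ₖ gives λ̄ₖz² ≤ z. -/
theorem norm_op_invSqrt_qBar_le
    (h : SpikedPerturbation Θ Γ lamBar qBar lamHat qHat D (K * D) η) (hSs : S.IsSymm)
    (hc : 0 < c) (hS : ∀ x, c * ‖x‖ ^ 2 ≤ ⟪x, op S x⟫) (k : Fin r) :
    ‖op (invSqrt (Θ + S)) (qBar k)‖ ≤ (√D)⁻¹ := by
  have hD := h.D_pos
  have hco := h.coercive_add hS
  refine abs_le_of_sq_le_sq' ?_ (by positivity) |>.2
  rw [norm_op_invSqrt_sq (h.low.isSymm.add hSs) hc hco, inv_pow, Real.sq_sqrt hD.le]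
  set y := op (Θ + S)⁻¹ (qBar k)
  have h1 : ⟪y, op (Θ + S) y⟫ = ⟪qBar k, y⟫ := by
    rw [op_op_inv (isUnit_of_coercive hc hco), real_inner_comm]
  have h2 : lamBar k * ⟪qBar k, y⟫ ^ 2 ≤ ⟪qBar k, y⟫ := by
    have h3 : 0 ≤ c * ‖y‖ ^ 2 := by positivity
    rw [inner_op_add] at h1
    linarith [h.inner_op_low_ge k y, hS y]
  have h3 := h.le_lamBar k
  rw [← one_div, le_div_iff₀ hD]
  by_contra! h4
  have h5 : 0 < ⟪qBar k, y⟫ := by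
    by_contra! h6
    nlinarith
  nlinarith

/-- In the equation for λ̂q̂, the vector Θq̂ is a combination of the q̄ and gains D^(-1/2); the rest
has length at most η and is divided by λ̂ ≥ D/2. -/
theorem norm_op_invSqrt_qHat_le
    (h : SpikedPerturbation Θ Γ lamBar qBar lamHat qHat D (K * D) η) (hSs : S.IsSymm)
    (hc : 0 < c) (hS : ∀ x, c * ‖x‖ ^ 2 ≤ ⟪x, op S x⟫) {k : Fin p} (hk : k.val < r) :
    ‖op (invSqrt (Θ + S)) (qHat k)‖ ≤ 2 * (r * K * (√D)⁻¹ + η / D * (√c)⁻¹) := by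
  have hD := h.D_pos
  have hη := h.η_nonneg
  set N := invSqrt (Θ + S)
  have h1 : lamHat k • qHat k = op Θ (qHat k) + op (Γ - Θ) (qHat k) := by
    rw [op_sub, ← h.full.op_eigenvector]; abel
  have h2 : lamHat k • op N (qHat k) = op N (op Θ (qHat k)) + op N (op (Γ - Θ) (qHat k)) := by
    rw [← map_smul, h1, map_add]
  have h3 : ‖op N (op Θ (qHat k))‖ ≤ r * (K * D * (√D)⁻¹) := by
    rw [h.low.op_eq, map_sum]
    calc _ ≤ ∑ _l : Fin r, K * D * (√D)⁻¹ := by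
          refine (norm_sum_le _ _).trans (Finset.sum_le_sum fun l _ => ?_)
          rw [map_smul, norm_smul, Real.norm_eq_abs, abs_mul,
            abs_of_pos (hD.trans_le (h.le_lamBar l))]
          have h4 := abs_inner_le_of_norm_eq_one (x := qHat k) (h.norm_qBar l)
          rw [h.norm_qHat] at h4
          have h5 := h.norm_op_invSqrt_qBar_le hSs hc hS l
          refine mul_le_mul ?_ h5 (norm_nonneg _) h.L_nonneg
          calc lamBar l * |⟪qBar l, qHat k⟫| ≤ K * D * 1 :=
                mul_le_mul (h.lamBar_le l) h4 (abs_nonneg _) h.L_nonneg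
            _ = K * D := mul_one _
      _ = _ := by simp
  have h4 : ‖op N (op (Γ - Θ) (qHat k))‖ ≤ (√c)⁻¹ * η := by
    refine (norm_op_invSqrt_le (h.low.isSymm.add hSs) hc (h.coercive_add hS) _).trans ?_
    have := h.norm_op_sub_le (qHat k)
    rw [h.norm_qHat, mul_one] at this
    gcongr
  have h5 : D / 2 ≤ lamHat k := by linarith [h.le_lamHat hk, h.small]
  have h6 : lamHat k * ‖op N (qHat k)‖ ≤ r * (K * D * (√D)⁻¹) + (√c)⁻¹ * η := by
    calc lamHat k * ‖op N (qHat k)‖ = ‖lamHat k • op N (qHat k)‖ := by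
          rw [norm_smul, Real.norm_of_nonneg (by linarith)]
      _ ≤ _ := by rw [h2]; exact (norm_add_le _ _).trans (add_le_add h3 h4)
  have h7 : D / 2 * ‖op N (qHat k)‖ ≤ D / 2 * (2 * (r * K * (√D)⁻¹ + η / D * (√c)⁻¹)) := by
    have e : D / 2 * (2 * (r * K * (√D)⁻¹ + η / D * (√c)⁻¹)) =
        r * (K * D * (√D)⁻¹) + (√c)⁻¹ * η := by field_simp
    rw [e]
    exact (mul_le_mul_of_nonneg_right h5 (norm_nonneg _)).trans h6
  exact le_of_mul_le_mul_left h7 (by linarith)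

/-- The error of the low-rank part in the relative Frobenius norm. -/
theorem frobNorm_invSqrt_mul_sub_le
    (h : SpikedPerturbation Θ Γ lamBar qBar lamHat qHat D (K * D) η) (hSs : S.IsSymm)
    (hc : 0 < c) (hS : ∀ x, c * ‖x‖ ^ 2 ≤ ⟪x, op S x⟫) (hK : 1 ≤ K) (hr : 1 ≤ r) :
    frobNorm (invSqrt (Θ + S) * (principalPart r lamHat qHat - Θ) * invSqrt (Θ + S)) ≤
      4 * (r ^ 2 * K * (η * (√D)⁻¹ * (√c)⁻¹ + η ^ 2 / D * c⁻¹)) := by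
  have hD := h.D_pos
  have hη := h.η_nonneg
  have hr' : (1 : ℝ) ≤ r := by exact_mod_cast hr
  refine (h.frobNorm_mul_principalPart_sub_mul_le (invSqrt (Θ + S)) (invSqrt_isSymm _)
    (a := 2 * (r * K * (√D)⁻¹ + η / D * (√c)⁻¹)) (b := (√c)⁻¹ * η)
    (a' := (√c)⁻¹ * (2 * η / D)) (b' := (√D)⁻¹) (by positivity) (by positivity)
    (by positivity) (fun k hk => h.norm_op_invSqrt_qHat_le hSs hc hS hk) (fun k => ?_)
    (fun k => ?_) (h.norm_op_invSqrt_qBar_le hSs hc hS)).trans ?_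
  · refine (norm_op_invSqrt_le (h.low.isSymm.add hSs) hc (h.coercive_add hS) _).trans ?_
    have := h.norm_op_sub_le (qHat k)
    rw [h.norm_qHat, mul_one] at this
    gcongr
  · refine (norm_op_invSqrt_le (h.low.isSymm.add hSs) hc (h.coercive_add hS) _).trans ?_
    have := h.norm_residual_le k
    gcongr
  · have e1 : (√c)⁻¹ * (√c)⁻¹ = c⁻¹ := by rw [← mul_inv, Real.mul_self_sqrt hc.le]
    have e2 : r * (2 * (r * K * (√D)⁻¹ + η / D * (√c)⁻¹) * ((√c)⁻¹ * η)) +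
        r * (K * D * ((√c)⁻¹ * (2 * η / D) * (√D)⁻¹)) =
        (2 * (r ^ 2 * K) + 2 * (r * K)) * (η * (√D)⁻¹ * (√c)⁻¹) +
          2 * r * (η ^ 2 / D * ((√c)⁻¹ * (√c)⁻¹)) := by
      field_simp
      ring
    rw [e2, e1]
    have h1 : 2 * (r ^ 2 * K) + 2 * (r * K) ≤ 4 * (r ^ 2 * K) := by
      linarith [mul_le_sq_mul hr' hK]
    have h2 : 2 * (r : ℝ) ≤ 4 * (r ^ 2 * K) := by linarith [le_sq_mul hr' hK]
    have h3 := mul_le_mul_of_nonneg_right h1 (show 0 ≤ η * (√D)⁻¹ * (√c)⁻¹ by positivity)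
    have h4 := mul_le_mul_of_nonneg_right h2 (show 0 ≤ η ^ 2 / D * c⁻¹ by positivity)
    linarith

/-- The error of the inverse. -/
theorem specNorm_inv_sub_inv_le
    (h : SpikedPerturbation Θ Γ lamBar qBar lamHat qHat D (K * D) η) (hSs : S.IsSymm)
    (hc : 0 < c) (hS : ∀ x, c * ‖x‖ ^ 2 ≤ ⟪x, op S x⟫) (hK : 1 ≤ K) {b : ℝ} (hcb : c ≤ b)
    (hSb : specNorm S ≤ b) {T : Matrix (Fin p) (Fin p) ℝ} (hT : specNorm (T - S) ≤ c / 2)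
    (hTc : ∀ x, c / 2 * ‖x‖ ^ 2 ≤ ⟪x, op T x⟫) :
    specNorm ((principalPart r lamHat qHat + T)⁻¹ - (Θ + S)⁻¹) ≤
      16 * (r * K * (c⁻¹) ^ 2 * (b * (η / D))) + 2 * (c⁻¹) ^ 2 * specNorm (T - S) := by
  have hD := h.D_pos
  have hη := h.η_nonneg
  have hc2 : 0 < c / 2 := by linarith
  have hco := h.coercive_add hS
  have hcoT := h.coercive_principalPart_add hTc
  have hGs : (Θ + S)⁻¹.IsSymm := by
    rw [Matrix.IsSymm, Matrix.transpose_nonsing_inv, (h.low.isSymm.add hSs).eq]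
  rw [inv_sub_inv_eq (isUnit_of_coercive hc2 hcoT) (isUnit_of_coercive hc hco), specNorm_neg]
  have e0 : principalPart r lamHat qHat + T - (Θ + S) =
      (principalPart r lamHat qHat - Θ) + (T - S) := by abel
  rw [e0, mul_add, add_mul]
  refine (specNorm_add_le _ _).trans (add_le_add ?_ ?_)
  · refine (specNorm_le_frobNorm _).trans ?_
    have hb0 : 0 < b := hc.trans_le hcb
    have hTb : specNorm T ≤ b + c / 2 := by
      have := specNorm_add_le S (T - S)
      rw [add_sub_cancel] at this
      linarith
    have hbc : 1 ≤ b * c⁻¹ := by rw [← div_eq_mul_inv, le_div_iff₀ hc]; linarith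
    -- Each inverse contracts its own leading eigenvectors by a factor of order (b/c)/D, which
    -- cancels the weight K D in the second sum and leaves η/D in both.
    refine (h.frobNorm_mul_principalPart_sub_mul_le _ hGs
      (a := 4 * (b * c⁻¹) / (D / 2)) (b := c⁻¹ * η)
      (a' := (c / 2)⁻¹ * (2 * η / D)) (b' := 2 * (b * c⁻¹) / D) (by positivity)
      (by positivity) (by positivity) (fun k hk => ?_) (fun k => ?_)
      (fun k => ?_) (fun k => ?_)).trans ?_
    · refine (norm_op_inv_eigenvector_le rfl hc2 (by linarith : 0 < D / 2) hcoT
        (op_principalPart_eigenvector lamHat h.full.orthonormal hk)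
        (by linarith [h.le_lamHat hk, h.small]) (h.norm_qHat k) hTb).trans ?_
      gcongr
      have : (c / 2)⁻¹ * (b + c / 2) = 2 * (b * c⁻¹) + 1 := by field_simp
      linarith
    · refine (norm_op_inv_le hc hco _).trans ?_
      have := h.norm_op_sub_le (qHat k)
      rw [h.norm_qHat, mul_one] at this
      gcongr
    · refine (norm_op_inv_le hc2 hcoT _).trans ?_
      have := h.norm_residual_le k
      gcongr
    · refine (norm_op_inv_eigenvector_le rfl hc hD hco (h.low.op_eigenvector k)
        (h.le_lamBar k) (h.norm_qBar k) hSb).trans ?_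
      gcongr
      linarith
    · have e1 : r * (4 * (b * c⁻¹) / (D / 2) * (c⁻¹ * η)) +
          r * (K * D * ((c / 2)⁻¹ * (2 * η / D) * (2 * (b * c⁻¹) / D))) =
          (8 * r + 8 * (r * K)) * ((c⁻¹) ^ 2 * (b * (η / D))) := by
        field_simp
        ring
      have h1 : 8 * (r : ℝ) + 8 * (r * K) ≤ 16 * (r * K) := by
        nlinarith [Nat.cast_nonneg (α := ℝ) r]
      rw [e1]
      have := mul_le_mul_of_nonneg_right h1
        (show 0 ≤ (c⁻¹) ^ 2 * (b * (η / D)) by positivity)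
      linarith
  · have h1 := specNorm_inv_le hc2 hcoT
    have h2 := specNorm_inv_le hc hco
    have h3 := specNorm_nonneg (T - S)
    have h4 := specNorm_nonneg (Θ + S)⁻¹
    calc _ ≤ specNorm (principalPart r lamHat qHat + T)⁻¹ * specNorm (T - S) *
          specNorm (Θ + S)⁻¹ := (specNorm_mul_le _ _).trans
            (mul_le_mul_of_nonneg_right (specNorm_mul_le _ _) h4)
      _ ≤ (c / 2)⁻¹ * specNorm (T - S) * c⁻¹ := by gcongr
      _ = _ := by rw [inv_div]; ring

end SpikedPerturbation

/-! ### Sparsity weights and adaptive thresholding. -/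

section Threshold

variable {p : ℕ} {S : Matrix (Fin p) (Fin p) ℝ} {c q b : ℝ}

theorem inner_single_op_single (S : Matrix (Fin p) (Fin p) ℝ) (i j : Fin p) :
    ⟪EuclideanSpace.single i (1 : ℝ), op S (EuclideanSpace.single j 1)⟫ = S i j := by
  rw [EuclideanSpace.inner_single_left, op_apply]
  simp

theorem le_diag (hS : ∀ x, c * ‖x‖ ^ 2 ≤ ⟪x, op S x⟫) (i : Fin p) : c ≤ S i i := by
  have := hS (EuclideanSpace.single i 1)
  rw [inner_single_op_single, PiLp.norm_single] at this
  simpa using this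

theorem abs_le_sqrt_diag (hs : S.IsSymm) (hc : 0 < c)
    (hS : ∀ x, c * ‖x‖ ^ 2 ≤ ⟪x, op S x⟫) (i j : Fin p) : |S i j| ≤ √(S i i * S j j) := by
  have hi' := hc.trans_le (le_diag hS i)
  have hi := hi'.le
  have hj' := hc.trans_le (le_diag hS j)
  have hj := hj'.le
  have key : ∀ a b : ℝ, 0 ≤ a ^ 2 * S i i + 2 * (a * b * S i j) + b ^ 2 * S j j := by
    intro a b
    have h := hS (a • EuclideanSpace.single i (1 : ℝ) + b • EuclideanSpace.single j (1 : ℝ))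
    have h0 : 0 ≤ c * ‖a • EuclideanSpace.single i (1 : ℝ) +
        b • EuclideanSpace.single j (1 : ℝ)‖ ^ 2 := by positivity
    rw [map_add, map_smul, map_smul, inner_add_left, inner_add_right, inner_add_right] at h
    simp only [real_inner_smul_left, inner_smul_right, inner_single_op_single] at h
    rw [hs.apply i j] at h
    linarith
  rw [Real.sqrt_mul hi]
  have e1 := Real.sq_sqrt hi
  have e2 := Real.sq_sqrt hj
  have h0 : 0 < √(S i i) * √(S j j) := by positivity
  rw [abs_le]
  -- The vectors √Sⱼⱼ eᵢ ± √Sᵢᵢ eⱼ are the extremal ones for the 2 × 2 minor.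
  have k1 := key √(S j j) √(S i i)
  have k2 := key √(S j j) (-√(S i i))
  rw [neg_sq, e1, e2] at k2
  rw [e1, e2] at k1
  have e3 : S i i * S j j = (√(S i i) * √(S j j)) ^ 2 := by rw [mul_pow, e1, e2]
  constructor <;> nlinarith

theorem absPow_nonneg (x q : ℝ) : 0 ≤ absPow x q := by
  unfold absPow; split_ifs <;> positivity

/-- The summand of the sparsity condition. -/
noncomputable def sparsityWeight (q : ℝ) (S : Matrix (Fin p) (Fin p) ℝ) (i j : Fin p) : ℝ :=
  absPow (S i j) q * (S i i * S j j) ^ ((1 - q) / 2)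

theorem sparsityWeight_comm (hs : S.IsSymm) (i j : Fin p) :
    sparsityWeight q S i j = sparsityWeight q S j i := by
  rw [sparsityWeight, sparsityWeight, hs.apply i j, mul_comm (S i i)]

theorem sparsityWeight_nonneg (hd : ∀ i, 0 ≤ S i i) (i j : Fin p) :
    0 ≤ sparsityWeight q S i j :=
  mul_nonneg (absPow_nonneg _ _) (Real.rpow_nonneg (mul_nonneg (hd i) (hd j)) _)

theorem sqrt_rpow_one_sub {x : ℝ} (hx : 0 ≤ x) (q : ℝ) : √x ^ (1 - q) = x ^ ((1 - q) / 2) := by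
  rw [Real.sqrt_eq_rpow, ← Real.rpow_mul hx]; congr 1; ring

/-- The exponents q and 1 - q add up to 1, so the sparsity condition also bounds the diagonal. -/
theorem sparsityWeight_diag {i : Fin p} (hd : 0 < S i i) : sparsityWeight q S i i = S i i := by
  have h : 0 ≤ S i i * S i i := by positivity
  rw [sparsityWeight, ← sqrt_rpow_one_sub h, Real.sqrt_mul_self hd.le, absPow,
    if_neg hd.ne', abs_of_pos hd, ← Real.rpow_add hd]
  simp

/-- Split |Sᵢⱼ| = |Sᵢⱼ|^q |Sᵢⱼ|^(1-q) and bound the second factor by Cauchy–Schwarz. -/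
theorem abs_le_sparsityWeight (hs : S.IsSymm) (hc : 0 < c)
    (hS : ∀ x, c * ‖x‖ ^ 2 ≤ ⟪x, op S x⟫) (hq : q < 1) (i j : Fin p) :
    |S i j| ≤ sparsityWeight q S i j := by
  have h0 : 0 ≤ S i i * S j j := mul_nonneg (hc.le.trans (le_diag hS i)) (hc.le.trans (le_diag hS j))
  rw [sparsityWeight, ← sqrt_rpow_one_sub h0, absPow]
  split_ifs with h
  · simp [h]
  · have hpos : 0 < |S i j| := abs_pos.2 h
    calc |S i j| = |S i j| ^ q * |S i j| ^ (1 - q) := by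
          rw [← Real.rpow_add hpos]; simp
      _ ≤ _ := mul_le_mul_of_nonneg_left (Real.rpow_le_rpow hpos.le
          (abs_le_sqrt_diag hs hc hS i j) (by linarith)) (by positivity)

theorem diag_le_of_isSparse (hc : 0 < c) (hS : ∀ x, c * ‖x‖ ^ 2 ≤ ⟪x, op S x⟫)
    (hsp : IsSparse q b S) (i : Fin p) : S i i ≤ b := by
  have hd := fun i => hc.trans_le (le_diag hS i)
  rw [← sparsityWeight_diag (q := q) (hd i)]
  exact (Finset.single_le_sum (f := fun j => sparsityWeight q S i j)
    (fun j _ => sparsityWeight_nonneg (fun i => (hd i).le) i j) (Finset.mem_univ i)).trans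
    (hsp i)

/-- The weights are symmetric, so the row bound also bounds columns, even if A is not symmetric. -/
theorem specNorm_le_of_weight {A : Matrix (Fin p) (Fin p) ℝ} {a : ℝ} (ha : 0 ≤ a) (hb : 0 ≤ b)
    (hs : S.IsSymm) (hsp : IsSparse q b S)
    (hA : ∀ i j, |A i j| ≤ a * sparsityWeight q S i j) : specNorm A ≤ a * b := by
  have hsum : ∀ i, ∑ j, a * sparsityWeight q S i j ≤ a * b := fun i => by
    rw [← Finset.mul_sum]; exact mul_le_mul_of_nonneg_left (hsp i) ha
  refine specNorm_le_of_sum_le (by positivity)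
    (fun i => (Finset.sum_le_sum fun j _ => hA i j).trans (hsum i)) fun j => ?_
  refine (Finset.sum_le_sum fun i _ => hA i j).trans ?_
  simp_rw [sparsityWeight_comm hs _ j]
  exact hsum j

theorem sum_abs_le_of_isSparse (hs : S.IsSymm) (hc : 0 < c)
    (hS : ∀ x, c * ‖x‖ ^ 2 ≤ ⟪x, op S x⟫) (hq : q < 1) (hsp : IsSparse q b S) (i : Fin p) :
    ∑ j, |S i j| ≤ b :=
  (Finset.sum_le_sum fun j _ => abs_le_sparsityWeight hs hc hS hq i j).trans (hsp i)

theorem specNorm_le_of_isSparse (hs : S.IsSymm) (hc : 0 < c)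
    (hS : ∀ x, c * ‖x‖ ^ 2 ≤ ⟪x, op S x⟫) (hq : q < 1) (hb : 0 ≤ b) (hsp : IsSparse q b S) :
    specNorm S ≤ b := by
  have := specNorm_le_of_weight zero_le_one hb hs hsp
    (fun i j => by rw [one_mul]; exact abs_le_sparsityWeight hs hc hS hq i j)
  rwa [one_mul] at this

variable {St : Matrix (Fin p) (Fin p) ℝ} {e w : ℝ} {t : Fin p → Fin p → ℝ → ℝ}

/-- As e ≤ c/2 ≤ Sᵢᵢ/2, estimated and true diagonal entries agree up to a factor 2. -/
theorem thresholdLevel_bounds (hc : 0 < c) (hd : ∀ i, c ≤ S i i)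
    (he : ∀ i j, |St i j - S i j| ≤ e) (hec : e ≤ c / 2) (hw : 0 ≤ w) (i j : Fin p) :
    w / 2 * √(S i i * S j j) ≤ thresholdLevel w St i j ∧
      thresholdLevel w St i j ≤ 2 * w * √(S i i * S j j) := by
  have hb : ∀ i, S i i / 2 ≤ max (St i i) 0 ∧ max (St i i) 0 ≤ 2 * S i i := by
    intro i
    have h1 := abs_le.1 (he i i)
    have h2 := hd i
    exact ⟨le_max_of_le_left (by linarith), max_le (by linarith) (by linarith)⟩
  have hi := hb i
  have hj := hb j
  have di := hc.trans_le (hd i)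
  have dj := hc.trans_le (hd j)
  have h1 : 1 / 2 * √(S i i * S j j) ≤ √(max (St i i) 0 * max (St j j) 0) := by
    refine Real.le_sqrt_of_sq_le ?_
    rw [mul_pow, Real.sq_sqrt (by positivity)]
    calc (1 / 2) ^ 2 * (S i i * S j j) = S i i / 2 * (S j j / 2) := by ring
      _ ≤ _ := mul_le_mul hi.1 hj.1 (by positivity) (by positivity)
  have h2 : √(max (St i i) 0 * max (St j j) 0) ≤ 2 * √(S i i * S j j) := by
    refine Real.sqrt_le_iff.2 ⟨by positivity, ?_⟩
    rw [mul_pow, Real.sq_sqrt (by positivity)]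
    calc _ ≤ 2 * S i i * (2 * S j j) := mul_le_mul hi.2 hj.2 (by positivity) (by positivity)
      _ = _ := by ring
  unfold thresholdLevel
  constructor
  · have := mul_le_mul_of_nonneg_left h1 hw; linarith
  · have := mul_le_mul_of_nonneg_left h2 hw; linarith

theorem le_sqrt_diag (hc : 0 < c) (hd : ∀ i, c ≤ S i i) (i j : Fin p) :
    c ≤ √(S i i * S j j) := by
  refine Real.le_sqrt_of_sq_le ?_
  rw [sq]
  exact mul_le_mul (hd i) (hd j) hc.le (hc.le.trans (hd i))

theorem two_mul_error_le_thresholdLevel (hc : 0 < c) (hd : ∀ i, c ≤ S i i)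
    (he : ∀ i j, |St i j - S i j| ≤ e) (hec : e ≤ c / 2) (hw : 0 ≤ w) (hew : 4 * e ≤ c * w)
    (i j : Fin p) : 2 * e ≤ thresholdLevel w St i j := by
  have h1 := (thresholdLevel_bounds hc hd he hec hw i j).1
  have h2 := mul_le_mul_of_nonneg_left (le_sqrt_diag hc hd i j) (show 0 ≤ w / 2 by linarith)
  linarith

theorem thresholded_diag_sub (hc : 0 < c) (hd : ∀ i, c ≤ S i i)
    (he : ∀ i j, |St i j - S i j| ≤ e) (hec : e ≤ c / 2) (i : Fin p) :
    |(thresholded w t St - S) i i| ≤ e := by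
  have h1 := abs_le.1 (he i i)
  have h2 := hd i
  rw [Matrix.sub_apply, thresholded, Matrix.of_apply, if_pos rfl,
    max_eq_left (by linarith)]
  exact he i i

/-- Off-diagonal entries of the thresholding error, absolute bound. -/
theorem thresholded_sub_le_level (hc : 0 < c) (hd : ∀ i, c ≤ S i i)
    (he : ∀ i j, |St i j - S i j| ≤ e) (hec : e ≤ c / 2) (hw : 0 ≤ w) (hew : 4 * e ≤ c * w)
    (ht : ∀ i j, i ≠ j → ∀ y, |t i j y - y| ≤ thresholdLevel w St i j) {i j : Fin p}
    (hij : i ≠ j) : |(thresholded w t St - S) i j| ≤ 3 / 2 * thresholdLevel w St i j := by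
  have h1 := two_mul_error_le_thresholdLevel hc hd he hec hw hew i j
  have h2 := he i j
  rw [Matrix.sub_apply, thresholded, Matrix.of_apply, if_neg hij]
  split_ifs with h
  · have h3 := ht i j hij (St i j)
    have := abs_add_le (t i j (St i j) - St i j) (St i j - S i j)
    rw [sub_add_sub_cancel] at this
    linarith
  · have := abs_add_le (S i j - St i j) (St i j)
    rw [sub_add_cancel, abs_sub_comm] at this
    rw [zero_sub, abs_neg]
    linarith [not_le.1 h]

/-- Off-diagonal entries of the thresholding error, sparsity-weighted bound. -/
theorem thresholded_sub_le_absPow (hc : 0 < c) (hd : ∀ i, c ≤ S i i)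
    (he : ∀ i j, |St i j - S i j| ≤ e) (hec : e ≤ c / 2) (hw : 0 < w) (hew : 4 * e ≤ c * w)
    (ht : ∀ i j, i ≠ j → ∀ y, |t i j y - y| ≤ thresholdLevel w St i j) (hq0 : 0 ≤ q)
    (hq1 : q < 1) {i j : Fin p} (hij : i ≠ j) :
    |(thresholded w t St - S) i j| ≤ 3 * (absPow (S i j) q * thresholdLevel w St i j ^ (1 - q)) := by
  have h1 := two_mul_error_le_thresholdLevel hc hd he hec hw.le hew i j
  have h2 := he i j
  have hl : 0 < thresholdLevel w St i j :=
    lt_of_lt_of_le (mul_pos (by linarith) (hc.trans_le (le_sqrt_diag hc hd i j)))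
      (thresholdLevel_bounds hc hd he hec hw.le i j).1
  have h3 := thresholded_sub_le_level hc hd he hec hw.le hew ht hij
  set l := thresholdLevel w St i j with hl_def
  -- A kept entry has |Sᵢⱼ| ≥ l/2, so l^q in l = l^q l^(1-q) may be traded for |Sᵢⱼ|^q. For a
  -- removed entry the error is Sᵢⱼ itself, at most 3l/2, and |Sᵢⱼ|^(1-q) is traded for l^(1-q).
  by_cases h : l ≤ |St i j|
  · have h4 : l / 2 ≤ |S i j| := by
      have := abs_add_le (St i j - S i j) (S i j)
      rw [sub_add_cancel] at this
      linarith
    have h5 : S i j ≠ 0 := abs_pos.1 (by linarith)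
    have h6 : l ^ q ≤ 2 * |S i j| ^ q := by
      calc l ^ q ≤ (2 * |S i j|) ^ q := Real.rpow_le_rpow hl.le (by linarith) hq0
        _ = 2 ^ q * |S i j| ^ q := Real.mul_rpow (by norm_num) (abs_nonneg _)
        _ ≤ 2 * |S i j| ^ q := by
            gcongr
            calc (2 : ℝ) ^ q ≤ 2 ^ (1 : ℝ) :=
                  Real.rpow_le_rpow_of_exponent_le (by norm_num) hq1.le
              _ = 2 := Real.rpow_one 2
    rw [absPow, if_neg h5]
    calc _ ≤ 3 / 2 * l := h3
      _ = 3 / 2 * (l ^ q * l ^ (1 - q)) := by rw [← Real.rpow_add hl]; simp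
      _ ≤ 3 / 2 * (2 * |S i j| ^ q * l ^ (1 - q)) := by gcongr
      _ = _ := by ring
  · have h4 : (thresholded w t St - S) i j = -S i j := by
      rw [Matrix.sub_apply, thresholded, Matrix.of_apply, if_neg hij, if_neg h, zero_sub]
    rw [h4, abs_neg] at h3 ⊢
    rw [absPow]
    split_ifs with h5
    · simp [h5]
    · have hpos : 0 < |S i j| := abs_pos.2 h5
      have h6 : |S i j| ^ (1 - q) ≤ 3 * l ^ (1 - q) := by
        calc |S i j| ^ (1 - q) ≤ (3 * l) ^ (1 - q) :=
              Real.rpow_le_rpow hpos.le (by linarith) (by linarith)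
          _ = 3 ^ (1 - q) * l ^ (1 - q) := Real.mul_rpow (by norm_num) hl.le
          _ ≤ 3 * l ^ (1 - q) := by
              gcongr
              calc (3 : ℝ) ^ (1 - q) ≤ 3 ^ (1 : ℝ) :=
                    Real.rpow_le_rpow_of_exponent_le (by norm_num) (by linarith)
                _ = 3 := Real.rpow_one 3
      calc |S i j| = |S i j| ^ q * |S i j| ^ (1 - q) := by rw [← Real.rpow_add hpos]; simp
        _ ≤ |S i j| ^ q * (3 * l ^ (1 - q)) := by gcongr
        _ = _ := by ring

theorem abs_thresholded_sub_le_weight (hc : 0 < c) (hd : ∀ i, c ≤ S i i)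
    (he : ∀ i j, |St i j - S i j| ≤ e) (hec : e ≤ c / 2) (hw : 0 < w) (hw1 : w ≤ 1)
    (hew : 4 * e ≤ c * w)
    (ht : ∀ i j, i ≠ j → ∀ y, |t i j y - y| ≤ thresholdLevel w St i j) (hq0 : 0 ≤ q)
    (hq1 : q < 1) (i j : Fin p) :
    |(thresholded w t St - S) i j| ≤ 3 * (2 * w) ^ (1 - q) * sparsityWeight q S i j := by
  have di := hc.trans_le (hd i)
  have dj := hc.trans_le (hd j)
  by_cases hij : i = j
  · subst hij
    rw [sparsityWeight_diag di]
    refine (thresholded_diag_sub hc hd he hec i).trans ?_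
    -- The diagonal error is linear in w; w ≤ 1 lifts it to the rate w^(1-q).
    have h1 : w ≤ (2 * w) ^ (1 - q) :=
      calc w = w ^ (1 : ℝ) := (Real.rpow_one w).symm
        _ ≤ w ^ (1 - q) := Real.rpow_le_rpow_of_exponent_ge hw hw1 (by linarith)
        _ ≤ (2 * w) ^ (1 - q) := Real.rpow_le_rpow hw.le (by linarith) (by linarith)
    have h2 : c * w ≤ S i i * (2 * w) ^ (1 - q) := mul_le_mul (hd i) h1 hw.le di.le
    have h3 : 0 < S i i * (2 * w) ^ (1 - q) := by positivity
    linarith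
  · refine (thresholded_sub_le_absPow hc hd he hec hw hew ht hq0 hq1 hij).trans ?_
    have h0 : 0 ≤ S i i * S j j := by positivity
    have h1 : thresholdLevel w St i j ^ (1 - q) ≤
        (2 * w) ^ (1 - q) * (S i i * S j j) ^ ((1 - q) / 2) := by
      rw [← sqrt_rpow_one_sub h0, ← Real.mul_rpow (by positivity) (Real.sqrt_nonneg _)]
      refine Real.rpow_le_rpow ?_ (thresholdLevel_bounds hc hd he hec hw.le i j).2
        (by linarith)
      unfold thresholdLevel; positivity
    calc _ ≤ 3 * (absPow (S i j) q * ((2 * w) ^ (1 - q) * (S i i * S j j) ^ ((1 - q) / 2))) := by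
          have := absPow_nonneg (S i j) q
          gcongr
      _ = _ := by rw [sparsityWeight]; ring

theorem abs_thresholded_sub_le_of_diag_le (hc : 0 < c) (hd : ∀ i, c ≤ S i i)
    (he : ∀ i j, |St i j - S i j| ≤ e) (hec : e ≤ c / 2) (hw : 0 < w) (hew : 4 * e ≤ c * w)
    (ht : ∀ i j, i ≠ j → ∀ y, |t i j y - y| ≤ thresholdLevel w St i j) {ν : ℝ}
    (hν : ∀ i, S i i ≤ ν) (i j : Fin p) : |(thresholded w t St - S) i j| ≤ 3 * w * ν := by
  have di := hc.trans_le (hd i)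
  have dj := hc.trans_le (hd j)
  have hcν : c ≤ ν := (hd i).trans (hν i)
  by_cases hij : i = j
  · subst hij
    refine (thresholded_diag_sub hc hd he hec i).trans ?_
    have h2 : c * w ≤ ν * w := mul_le_mul_of_nonneg_right hcν hw.le
    have : 0 < ν * w := mul_pos (by linarith) hw
    linarith
  · refine (thresholded_sub_le_level hc hd he hec hw.le hew ht hij).trans ?_
    have h1 := (thresholdLevel_bounds hc hd he hec hw.le i j).2
    have h2 : √(S i i * S j j) ≤ ν := by
      refine Real.sqrt_le_iff.2 ⟨by linarith, ?_⟩
      rw [sq]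
      exact mul_le_mul (hν i) (hν j) dj.le (by linarith)
    have h3 := mul_le_mul_of_nonneg_left h2 (show 0 ≤ 2 * w by linarith)
    linarith

end Threshold

/-! ### Consequences of the factor conditions. -/

section Eigengap

variable {r : ℕ} {lam : Fin r → ℝ}

/-- By the convention λᵣ₊₁ = 0 the last gap is the smallest eigenvalue itself. -/
theorem eigengap_le (hl : Antitone lam) (k : Fin r) : eigengap lam ≤ lam k := by
  have hr : 0 < r := k.pos
  have h1 : eigengap lam ≤ lam ⟨r - 1, by omega⟩ := by
    have := ciInf_le (f := fun i : Fin r => (lam i -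
      if h : (i : ℕ) + 1 < r then lam ⟨i + 1, h⟩ else 0)) (Set.finite_range _).bddBelow
      ⟨r - 1, by omega⟩
    rw [dif_neg (by simp; omega), sub_zero] at this
    exact this
  exact h1.trans (hl (by rw [Fin.le_def]; have := k.2; simp; omega))

end Eigengap

section Conditions

variable {p r : ℕ} {C₁ C₂ C₃ c₀ q s M : ℝ} {Θ S : Matrix (Fin p) (Fin p) ℝ}
  {lamBar : Fin r → ℝ} {qBar : Fin r → EuclideanSpace ℝ (Fin p)}

theorem FactorConditions.dim_pos (h : FactorConditions C₁ C₂ C₃ c₀ q s M Θ S lamBar qBar)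
    (hr : 1 ≤ r) : 0 < p := by
  rcases Nat.eq_zero_or_pos p with rfl | hp
  · have h1 := h.decomposition.orthonormal.1 ⟨0, hr⟩
    rw [Subsingleton.elim (qBar ⟨0, hr⟩) 0, norm_zero] at h1
    exact absurd h1 zero_ne_one
  · exact hp

theorem FactorConditions.coercive (h : FactorConditions C₁ C₂ C₃ c₀ q s M Θ S lamBar qBar)
    (x : EuclideanSpace ℝ (Fin p)) : c₀ * ‖x‖ ^ 2 ≤ ⟪x, op S x⟫ :=
  le_inner_op_of_spectrum h.symm h.eigenvalue_ge x

/-- Any diagonal entry of S lies between c₀ and M s. This lets β be absorbed into M s β and later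
forces p → ∞. -/
theorem FactorConditions.le_mul (h : FactorConditions C₁ C₂ C₃ c₀ q s M Θ S lamBar qBar)
    (hr : 1 ≤ r) (hc₀ : 0 < c₀) : c₀ ≤ M * s :=
  (le_diag h.coercive ⟨0, h.dim_pos hr⟩).trans
    (diag_le_of_isSparse hc₀ h.coercive h.sparse _)

theorem FactorConditions.eigengap_pos
    (h : FactorConditions C₁ C₂ C₃ c₀ q s M Θ S lamBar qBar) (hr : 1 ≤ r) (hC₂ : 0 < C₂) :
    0 < eigengap lamBar := by
  have : (0 : ℝ) < p := by exact_mod_cast h.dim_pos hr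
  exact lt_of_lt_of_le (by positivity) h.pervasive

theorem FactorConditions.lamBar_le (h : FactorConditions C₁ C₂ C₃ c₀ q s M Θ S lamBar qBar)
    (hr : 1 ≤ r) (hC₂ : 0 < C₂) (hc₀ : 0 < c₀) (k : Fin r) :
    lamBar k ≤ max C₁ 1 * eigengap lamBar := by
  have hD := h.eigengap_pos hr hC₂
  have h1 := inner_op_le_largestEigenvalue (h.decomposition.isSymm.add h.symm) (qBar k)
  rw [SpikedPerturbation.inner_op_add, h.decomposition.op_eigenvector, inner_smul_right,
    real_inner_self_eq_norm_sq, h.decomposition.orthonormal.1 k] at h1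
  have h2 := h.coercive (qBar k)
  rw [h.decomposition.orthonormal.1 k] at h2
  have h3 := (div_le_iff₀ hD).1 h.spiked
  have h4 : 0 ≤ p * M := mul_nonneg (Nat.cast_nonneg _) h.M_pos.le
  have h5 := mul_le_mul_of_nonneg_right (le_max_left C₁ 1) hD.le
  linarith

theorem FactorConditions.abs_qBar_le
    (h : FactorConditions C₁ C₂ C₃ c₀ q s M Θ S lamBar qBar) (hr : 1 ≤ r) (k : Fin r)
    (i : Fin p) : |qBar k i| ≤ √(max C₃ 1 * r / p) := by
  have hp : (0 : ℝ) < p := by exact_mod_cast h.dim_pos hr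
  have hr' : (0 : ℝ) < r := by exact_mod_cast hr
  refine Real.abs_le_sqrt ?_
  have h1 : qBar k i ^ 2 ≤ ∑ k, qBar k i ^ 2 :=
    Finset.single_le_sum (f := fun k => qBar k i ^ 2) (fun _ _ => sq_nonneg _)
      (Finset.mem_univ k)
  have h2 : (p : ℝ) / r * qBar k i ^ 2 ≤ max C₃ 1 :=
    (mul_le_mul_of_nonneg_left h1 (by positivity)).trans
      ((h.incoherent i).trans (le_max_left _ _))
  rw [le_div_iff₀ hp]
  rw [div_mul_eq_mul_div, div_le_iff₀ hr'] at h2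
  linarith

/-- The row sums are at most M s + p Cin τ ≤ (1 + Cin)pβ, and D ≥ C₂p turns smallness of β into 4η ≤
D. -/
theorem FactorConditions.spikedPerturbation
    (h : FactorConditions C₁ C₂ C₃ c₀ q s M Θ S lamBar qBar) (hr : 1 ≤ r) (hC₂ : 0 < C₂)
    (hc₀ : 0 < c₀) (hq₁ : q < 1) {Cin τ β : ℝ} (hCin : 0 < Cin) (hτ : 0 ≤ τ)
    (hβ : β = M * s / p + τ) {Γ : Matrix (Fin p) (Fin p) ℝ} {lamHat : Fin p → ℝ}
    {qHat : Fin p → EuclideanSpace ℝ (Fin p)} (hΓ : IsSpectralDecomposition Γ lamHat qHat)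
    (hclose : maxNorm (Γ - (Θ + S)) ≤ Cin * τ) (hsmall : 4 * (1 + Cin) * β ≤ C₂) :
    SpikedPerturbation Θ Γ lamBar qBar lamHat qHat (eigengap lamBar)
      (max C₁ 1 * eigengap lamBar) ((1 + Cin) * (p * β)) := by
  have hp : (0 : ℝ) < p := by exact_mod_cast h.dim_pos hr
  have hD := h.eigengap_pos hr hC₂
  have hb := hc₀.trans_le (h.le_mul hr hc₀)
  have hK : 0 < max C₁ 1 := lt_max_of_lt_right one_pos
  have hpβ : p * β = M * s + p * τ := by rw [hβ]; field_simp
  have hβ0 : 0 ≤ β := by rw [hβ]; positivity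
  refine ⟨h.decomposition, hΓ, hD, eigengap_le h.decomposition.antitone,
    h.lamBar_le hr hC₂ hc₀, by positivity, fun i => ?_, by positivity, ?_⟩
  · calc ∑ j, |(Γ - Θ) i j| ≤ ∑ j, (|S i j| + Cin * τ) := by
          refine Finset.sum_le_sum fun j _ => ?_
          have h1 := (abs_le_maxNorm (Γ - (Θ + S)) i j).trans hclose
          have h2 : (Γ - Θ) i j = S i j + (Γ - (Θ + S)) i j := by
            simp only [Matrix.sub_apply, Matrix.add_apply]; ring
          rw [h2]
          exact (abs_add_le _ _).trans (by linarith)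
      _ ≤ M * s + p * (Cin * τ) := by
          rw [Finset.sum_add_distrib]
          simp only [Finset.sum_const, Finset.card_univ, Fintype.card_fin, nsmul_eq_mul]
          linarith [sum_abs_le_of_isSparse h.symm hc₀ h.coercive hq₁ h.sparse i]
      _ ≤ (1 + Cin) * (p * β) := by
          rw [hpβ]
          have : 0 ≤ Cin * (M * s) := by positivity
          have : 0 ≤ p * τ := by positivity
          linarith
  · refine le_trans ?_ h.pervasive
    calc 4 * ((1 + Cin) * (p * β)) = 4 * (1 + Cin) * β * p := by ring
      _ ≤ C₂ * p := mul_le_mul_of_nonneg_right hsmall hp.le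

theorem FactorConditions.abs_principalPart_sub_le
    (h : FactorConditions C₁ C₂ C₃ c₀ q s M Θ S lamBar qBar) (hr : 1 ≤ r) {R : ℕ}
    (hrR : r ≤ R) {H β : ℝ} (hH : 0 ≤ H) (hβ : 0 ≤ β) {Γ : Matrix (Fin p) (Fin p) ℝ}
    {lamHat : Fin p → ℝ} {qHat : Fin p → EuclideanSpace ℝ (Fin p)}
    (hP : SpikedPerturbation Θ Γ lamBar qBar lamHat qHat (eigengap lamBar)
      (max C₁ 1 * eigengap lamBar) (H * (p * β))) (i j : Fin p) :
    |(principalPart r lamHat qHat - Θ) i j| ≤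
      14 * R ^ 4 * max C₁ 1 ^ 2 * max C₃ 1 * H * β := by
  have hp : (0 : ℝ) < p := by exact_mod_cast h.dim_pos hr
  have hK : 0 < max C₃ 1 := lt_max_of_lt_right one_pos
  refine (hP.abs_principalPart_sub_le (h.abs_qBar_le hr) (Real.sqrt_nonneg _)
    (le_max_right _ _) i j).trans ?_
  rw [Real.sq_sqrt (by positivity)]
  have e1 : 14 * ((r : ℝ) ^ 3 * max C₁ 1 ^ 2 * (max C₃ 1 * r / p) * (H * (p * β))) =
      14 * r ^ 4 * max C₁ 1 ^ 2 * max C₃ 1 * H * β := by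
    field_simp
  rw [e1]
  gcongr

theorem SpikedPerturbation.relFrobNorm_le {Γ : Matrix (Fin p) (Fin p) ℝ} {lamHat : Fin p → ℝ}
    {qHat : Fin p → EuclideanSpace ℝ (Fin p)} {D K η c : ℝ}
    (h : SpikedPerturbation Θ Γ lamBar qBar lamHat qHat D (K * D) η) (hSs : S.IsSymm)
    (hc : 0 < c) (hS : ∀ x, c * ‖x‖ ^ 2 ≤ ⟪x, op S x⟫) (hK : 1 ≤ K) (hr : 1 ≤ r) (hp : 0 < p)
    (T : Matrix (Fin p) (Fin p) ℝ) :
    relFrobNorm (Θ + S) (principalPart r lamHat qHat + T - (Θ + S)) ≤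
      (√p)⁻¹ * (4 * (r ^ 2 * K * (η * (√D)⁻¹ * (√c)⁻¹ + η ^ 2 / D * c⁻¹))) +
        c⁻¹ * specNorm (T - S) := by
  have hp' : (0 : ℝ) < √p := Real.sqrt_pos.2 (by exact_mod_cast hp)
  have e0 : principalPart r lamHat qHat + T - (Θ + S) =
      (principalPart r lamHat qHat - Θ) + (T - S) := by abel
  rw [relFrobNorm_eq, e0, mul_add, add_mul]
  have h1 := h.frobNorm_invSqrt_mul_sub_le hSs hc hS hK hr
  have hN : specNorm (invSqrt (Θ + S)) ≤ (√c)⁻¹ := specNorm_le (by positivity)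
    (norm_op_invSqrt_le (h.low.isSymm.add hSs) hc (h.coercive_add hS))
  have h2 : frobNorm (invSqrt (Θ + S) * (T - S) * invSqrt (Θ + S)) ≤
      √p * (c⁻¹ * specNorm (T - S)) := by
    refine (frobNorm_le_sqrt_mul_specNorm _).trans (mul_le_mul_of_nonneg_left ?_ hp'.le)
    have h3 := specNorm_nonneg (T - S)
    have h4 := specNorm_nonneg (invSqrt (Θ + S))
    calc _ ≤ specNorm (invSqrt (Θ + S)) * specNorm (T - S) * specNorm (invSqrt (Θ + S)) :=
          (specNorm_mul_le _ _).trans (mul_le_mul_of_nonneg_right (specNorm_mul_le _ _) h4)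
      _ ≤ (√c)⁻¹ * specNorm (T - S) * (√c)⁻¹ := by gcongr
      _ = ((√c)⁻¹ * (√c)⁻¹) * specNorm (T - S) := by ring
      _ = c⁻¹ * specNorm (T - S) := by rw [← mul_inv, Real.mul_self_sqrt hc.le]
  calc _ ≤ (√p)⁻¹ * (4 * (r ^ 2 * K * (η * (√D)⁻¹ * (√c)⁻¹ + η ^ 2 / D * c⁻¹)) +
        √p * (c⁻¹ * specNorm (T - S))) :=
        mul_le_mul_of_nonneg_left ((frobNorm_add_le _ _).trans (add_le_add h1 h2))
          (by positivity)
    _ = _ := by rw [mul_add, inv_mul_cancel_left₀ hp'.ne']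

/-- The rate of the low-rank part in the relative Frobenius norm. -/
theorem relative_rate_le {P D H C c b τ β B : ℝ} (hP : 1 ≤ P) (hC : 0 < C) (hH : 0 < H)
    (hc : 0 < c) (hD : C * P ≤ D) (hcb : c ≤ b) (hτ : 0 ≤ τ) (hβ : β = b / P + τ)
    (hB : b * β ≤ B) :
    (√P)⁻¹ * (H * (P * β) * (√D)⁻¹ * (√c)⁻¹ + (H * (P * β)) ^ 2 / D * c⁻¹) ≤
      (H * (√C)⁻¹ * (√c)⁻¹ * c⁻¹ + 2 * H ^ 2 * C⁻¹ * c⁻¹) * (√P * τ ^ 2 + B) := by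
  have hP0 : 0 < P := by linarith
  have hb : 0 < b := by linarith
  have hβ0 : 0 ≤ β := by rw [hβ]; positivity
  have hsP : 1 ≤ √P := Real.one_le_sqrt.2 hP
  have hs2 : √P ^ 2 = P := Real.sq_sqrt hP0.le
  have hs0 : 0 < √P := by linarith
  have hCs : 0 < √C := Real.sqrt_pos.2 hC
  have hB0 : 0 ≤ B := le_trans (by positivity) hB
  have h1 : (√D)⁻¹ ≤ (√C)⁻¹ * (√P)⁻¹ := by
    rw [← mul_inv, ← Real.sqrt_mul hC.le]
    exact inv_anti₀ (Real.sqrt_pos.2 (by positivity)) (Real.sqrt_le_sqrt hD)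
  have h2 : D⁻¹ ≤ C⁻¹ * P⁻¹ := by
    rw [← mul_inv]; exact inv_anti₀ (by positivity) hD
  have h3 : β ≤ c⁻¹ * B := by
    rw [inv_mul_eq_div, le_div_iff₀ hc]
    nlinarith
  -- The square of β splits into τ² and (b/P)²; the latter, times √P ≤ P, is at most bβ.
  have h4 : √P * β ^ 2 ≤ 2 * (√P * τ ^ 2 + B) := by
    have h5 : β ^ 2 ≤ 2 * (b / P) ^ 2 + 2 * τ ^ 2 := by
      rw [hβ]; nlinarith [sq_nonneg (b / P - τ)]
    have h6 : √P * (b / P) ^ 2 ≤ B := by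
      have h7 : b / P ≤ β := by rw [hβ]; linarith
      have h8 : √P / P ≤ 1 := by
        rw [div_le_one hP0]; nlinarith
      calc √P * (b / P) ^ 2 = √P / P * (b * (b / P)) := by field_simp
        _ ≤ 1 * (b * β) := by gcongr
        _ ≤ B := by linarith
    nlinarith
  have t1 : (√P)⁻¹ * (H * (P * β) * (√D)⁻¹ * (√c)⁻¹) ≤ H * (√C)⁻¹ * (√c)⁻¹ * c⁻¹ * B := by
    calc (√P)⁻¹ * (H * (P * β) * (√D)⁻¹ * (√c)⁻¹)
        ≤ (√P)⁻¹ * (H * (P * β) * ((√C)⁻¹ * (√P)⁻¹) * (√c)⁻¹) := by gcongr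
      _ = H * (√C)⁻¹ * (√c)⁻¹ * β * (P * ((√P)⁻¹) ^ 2) := by ring
      _ = H * (√C)⁻¹ * (√c)⁻¹ * β := by
          rw [inv_pow, hs2, mul_inv_cancel₀ hP0.ne', mul_one]
      _ ≤ H * (√C)⁻¹ * (√c)⁻¹ * (c⁻¹ * B) := by gcongr
      _ = _ := by ring
  have t2 : (√P)⁻¹ * ((H * (P * β)) ^ 2 / D * c⁻¹) ≤
      2 * H ^ 2 * C⁻¹ * c⁻¹ * (√P * τ ^ 2 + B) := by
    calc (√P)⁻¹ * ((H * (P * β)) ^ 2 / D * c⁻¹)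
        = (√P)⁻¹ * ((H * (P * β)) ^ 2 * D⁻¹ * c⁻¹) := by rw [div_eq_mul_inv]
      _ ≤ (√P)⁻¹ * ((H * (P * β)) ^ 2 * (C⁻¹ * P⁻¹) * c⁻¹) := by gcongr
      _ = H ^ 2 * C⁻¹ * c⁻¹ * ((√P)⁻¹ * P * β ^ 2) := by field_simp
      _ = H ^ 2 * C⁻¹ * c⁻¹ * (√P * β ^ 2) := by
          congr 2
          rw [inv_mul_eq_div, div_eq_iff hs0.ne', ← sq, hs2]
      _ ≤ H ^ 2 * C⁻¹ * c⁻¹ * (2 * (√P * τ ^ 2 + B)) := by gcongr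
      _ = _ := by ring
  have t3 : 0 ≤ H * (√C)⁻¹ * (√c)⁻¹ * c⁻¹ * (√P * τ ^ 2) := by positivity
  rw [mul_add]
  linarith

end Conditions

/-! ### Choice of constants and the deterministic bounds. -/

set_option maxHeartbeats 1600000 in
/-- The four error bounds at one outcome at which the input estimator is accurate and `β` is
small. -/
theorem exists_deterministic_bounds (C₁ C₂ C₃ c₀ Cin ν q : ℝ) (R : ℕ)
    (hC₂ : 0 < C₂) (hc₀ : 0 < c₀) (hCin : 0 < Cin) (hq₀ : 0 ≤ q) (hq₁ : q < 1) :
    ∃ W : ℝ, 0 < W ∧ ∀ Cw : ℝ, W ≤ Cw → ∃ C ε δ : ℝ, 0 < C ∧ 0 < ε ∧ 0 < δ ∧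
    ∀ {p r : ℕ} {s M τ β : ℝ} {Θ S Γ : Matrix (Fin p) (Fin p) ℝ} {lamBar : Fin r → ℝ}
      {qBar : Fin r → EuclideanSpace ℝ (Fin p)} {lamHat : Fin p → ℝ}
      {qHat : Fin p → EuclideanSpace ℝ (Fin p)} {t : Fin p → Fin p → ℝ → ℝ}
      {St T : Matrix (Fin p) (Fin p) ℝ},
      1 ≤ r → r ≤ R → 0 ≤ τ → β = M * s / p + τ →
      FactorConditions C₁ C₂ C₃ c₀ q s M Θ S lamBar qBar →
      IsSpectralDecomposition Γ lamHat qHat →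
      maxNorm (Γ - (Θ + S)) ≤ Cin * τ →
      St = Γ - principalPart r lamHat qHat →
      T = thresholded (Cw * β) t St →
      (∀ i j, i ≠ j → ∀ y, |t i j y - y| ≤ thresholdLevel (Cw * β) St i j) →
      β ≤ ε →
      specNorm (T - S) ≤ C * (M * s * β ^ (1 - q)) ∧
      relFrobNorm (Θ + S) (principalPart r lamHat qHat + T - (Θ + S)) ≤
        C * (√p * τ ^ 2 + M * s * β ^ (1 - q)) ∧
      ((∀ i, S i i ≤ ν) → maxNorm (T - S) ≤ C * β ∧
        maxNorm (principalPart r lamHat qHat + T - (Θ + S)) ≤ C * β) ∧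
      (M * s * β ^ (1 - q) ≤ δ →
        (∀ μ ∈ spectrum ℝ T, c₀ / 2 ≤ μ) ∧ IsUnit (principalPart r lamHat qHat + T) ∧
        specNorm (T⁻¹ - S⁻¹) ≤ C * (M * s * β ^ (1 - q)) ∧
        specNorm ((principalPart r lamHat qHat + T)⁻¹ - (Θ + S)⁻¹) ≤
          C * (M * s * β ^ (1 - q))) := by
  set K := max C₁ 1 with hK_def
  set H := 1 + Cin with hH_def
  set N := max ν 1 with hN_def
  have hK : 1 ≤ K := le_max_right _ _
  have hK0 : 0 < K := by linarith
  have hC₃ : 0 < max C₃ 1 := lt_max_of_lt_right one_pos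
  have hH : 0 < H := by linarith
  have hN : 0 < N := lt_max_of_lt_right one_pos
  set K₀ := 14 * R ^ 4 * K ^ 2 * max C₃ 1 * H with hK₀_def
  have hK₀ : 0 ≤ K₀ := by positivity
  set K₁ := Cin + K₀ with hK₁_def
  have hK₁ : 0 < K₁ := by linarith
  -- K₁β will bound the entrywise error of `St`; this W yields 4K₁β ≤ c₀(Cw β), so thresholds are at
  -- least twice the error.
  refine ⟨4 * K₁ / c₀, by positivity, fun Cw hCw => ?_⟩
  have hCw0 : 0 < Cw := lt_of_lt_of_le (by positivity) hCw
  have hCw' : 4 * K₁ ≤ c₀ * Cw := by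
    rw [div_le_iff₀ hc₀] at hCw; linarith
  set A₁ := 3 * (2 * Cw) ^ (1 - q) with hA₁_def
  have hA₁ : 0 < A₁ := by positivity
  set A₂ := 4 * R ^ 2 * K * (H * (√C₂)⁻¹ * (√c₀)⁻¹ * c₀⁻¹ + 2 * H ^ 2 * C₂⁻¹ * c₀⁻¹) +
    c₀⁻¹ * A₁ with hA₂_def
  have hA₂ : 0 ≤ A₂ := by positivity
  set A₃ := K₀ + 3 * Cw * N with hA₃_def
  have hA₃ : 0 ≤ A₃ := by positivity
  set A₄ := 16 * (R * K * (c₀⁻¹) ^ 2 * (H * C₂⁻¹)) + 2 * (c₀⁻¹) ^ 2 * A₁ with hA₄_def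
  have hA₄ : 0 ≤ A₄ := by positivity
  -- The four bounds in ε give 4η ≤ D, error at most c₀/2, threshold constant at most 1, and β ≤ 1.
  -- The choice of δ makes A₁B ≤ c₀/2, so that T stays coercive.
  refine ⟨A₁ + A₂ + A₃ + A₄, min (min (C₂ / (4 * H)) (c₀ / (2 * K₁))) (min (1 / Cw) 1),
    c₀ / (2 * A₁), by positivity, by positivity, by positivity, ?_⟩
  intro p r s M τ β Θ S Γ lamBar qBar lamHat qHat t St T hr hrR hτ hβ hF hΓ hclose hSt hT ht hβε
  have hp : 0 < p := hF.dim_pos hr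
  have hp1 : (1 : ℝ) ≤ p := by exact_mod_cast hp
  have hp0 : (0 : ℝ) < p := by linarith
  have hrR' : (r : ℝ) ≤ R := by exact_mod_cast hrR
  have hb := hF.le_mul hr hc₀
  have hb0 := hc₀.trans_le hb
  have hβ0 : 0 < β := by rw [hβ]; positivity
  have hβ1 : 4 * H * β ≤ C₂ := by
    have := hβε.trans ((min_le_left _ _).trans (min_le_left _ _))
    rw [le_div_iff₀ (by positivity)] at this; linarith
  have hβ2 : K₁ * β ≤ c₀ / 2 := by
    have := hβε.trans ((min_le_left _ _).trans (min_le_right _ _))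
    rw [le_div_iff₀ (by positivity)] at this; linarith
  have hβ3 : Cw * β ≤ 1 := by
    have := hβε.trans ((min_le_right _ _).trans (min_le_left _ _))
    rw [le_div_iff₀ hCw0] at this; linarith
  have hβ4 : β ≤ 1 := hβε.trans ((min_le_right _ _).trans (min_le_right _ _))
  have hτβ : τ ≤ β := by
    have : 0 ≤ M * s / p := by positivity
    linarith
  have hco := hF.coercive
  have hd := le_diag hco
  have hsp := hF.spikedPerturbation hr hC₂ hc₀ hq₁ hCin hτ hβ hΓ hclose hβ1
  have hD := hsp.D_pos
  have hΔ := hF.abs_principalPart_sub_le hr hrR hH.le hβ0.le hsp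
  rw [← hK_def, ← hK₀_def] at hΔ
  rw [← hK_def] at hsp
  have he : ∀ i j, |St i j - S i j| ≤ K₁ * β := fun i j => by
    have h1 := (abs_le_maxNorm (Γ - (Θ + S)) i j).trans hclose
    have h2 : St i j - S i j = (Γ - (Θ + S)) i j - (principalPart r lamHat qHat - Θ) i j := by
      rw [hSt]; simp only [Matrix.sub_apply, Matrix.add_apply]; ring
    rw [h2]
    have h3 := mul_le_mul_of_nonneg_left hτβ hCin.le
    exact (abs_sub _ _).trans (by linarith [hΔ i j])
  have hw : 0 < Cw * β := by positivity
  have hew : 4 * (K₁ * β) ≤ c₀ * (Cw * β) := by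
    have := mul_le_mul_of_nonneg_right hCw' hβ0.le
    linarith
  set B := M * s * β ^ (1 - q) with hB_def
  have hB0 : 0 ≤ B := by positivity
  have hββ : β ≤ β ^ (1 - q) := by
    calc β = β ^ (1 : ℝ) := (Real.rpow_one β).symm
      _ ≤ β ^ (1 - q) := Real.rpow_le_rpow_of_exponent_ge hβ0 hβ4 (by linarith)
  have hbβ : M * s * β ≤ B := mul_le_mul_of_nonneg_left hββ hb0.le
  have hspec : specNorm (T - S) ≤ A₁ * B := by
    have h1 := specNorm_le_of_weight (a := 3 * (2 * (Cw * β)) ^ (1 - q)) (by positivity) hb0.le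
      hF.symm hF.sparse
      (abs_thresholded_sub_le_weight hc₀ hd he hβ2 hw hβ3 hew ht hq₀ hq₁)
    rw [← hT, ← mul_assoc 2 Cw, Real.mul_rpow (by positivity) hβ0.le] at h1
    exact h1.trans (le_of_eq (by rw [hA₁_def, hB_def]; ring))
  refine ⟨?_, ?_, fun hν => ?_, fun hBδ => ?_⟩
  · exact hspec.trans (mul_le_mul_of_nonneg_right (by linarith) hB0)
  · have h1 := hsp.relFrobNorm_le hF.symm hc₀ hco hK hr hp T
    have h2 := relative_rate_le hp1 hC₂ hH hc₀ hF.pervasive hb hτ hβ hbβ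
    set Q := √(p : ℝ) * τ ^ 2 + B with hQ
    have hQ0 : 0 ≤ Q := by positivity
    have hBQ : B ≤ Q := by rw [hQ]; linarith [show 0 ≤ √(p : ℝ) * τ ^ 2 by positivity]
    refine h1.trans ?_
    calc _ = 4 * r ^ 2 * K * ((√p)⁻¹ * (H * (p * β) * (√(eigengap lamBar))⁻¹ * (√c₀)⁻¹ +
            (H * (p * β)) ^ 2 / eigengap lamBar * c₀⁻¹)) + c₀⁻¹ * specNorm (T - S) := by ring
      _ ≤ 4 * R ^ 2 * K * ((H * (√C₂)⁻¹ * (√c₀)⁻¹ * c₀⁻¹ + 2 * H ^ 2 * C₂⁻¹ * c₀⁻¹) * Q) +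
            c₀⁻¹ * (A₁ * Q) := by
          gcongr
          exact hspec.trans (by gcongr)
      _ = A₂ * Q := by rw [hA₂_def]; ring
      _ ≤ _ := mul_le_mul_of_nonneg_right (by linarith) hQ0
  · have hν' : ∀ i, S i i ≤ N := fun i => (hν i).trans (le_max_left _ _)
    have h1 := abs_thresholded_sub_le_of_diag_le hc₀ hd he hβ2 hw hew ht hν'
    rw [← hT] at h1
    have h2 : K₀ * β + 3 * (Cw * β) * N ≤ (A₁ + A₂ + A₃ + A₄) * β := by
      calc _ = A₃ * β := by rw [hA₃_def]; ring
        _ ≤ _ := mul_le_mul_of_nonneg_right (by linarith) hβ0.le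
    have h3 : 0 ≤ K₀ * β := by positivity
    refine ⟨maxNorm_le (by positivity) fun i j => (h1 i j).trans (by linarith),
      maxNorm_le (by positivity) fun i j => ?_⟩
    have e0 : (principalPart r lamHat qHat + T - (Θ + S)) i j =
        (principalPart r lamHat qHat - Θ) i j + (T - S) i j := by
      simp only [Matrix.sub_apply, Matrix.add_apply]; ring
    rw [e0]
    exact (abs_add_le _ _).trans (by linarith [hΔ i j, h1 i j])
  · have hTS : specNorm (T - S) ≤ c₀ / 2 := by
      rw [le_div_iff₀ (by positivity)] at hBδ
      linarith
    have hTc : ∀ x, c₀ / 2 * ‖x‖ ^ 2 ≤ ⟪x, op T x⟫ := fun x => by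
      have h1 : ⟪x, op T x⟫ = ⟪x, op S x⟫ + ⟪x, op (T - S) x⟫ := by
        rw [← SpikedPerturbation.inner_op_add, add_sub_cancel]
      have h2 := (abs_le.1 (abs_real_inner_le_norm x (op (T - S) x))).1
      have h3 : ‖op (T - S) x‖ ≤ c₀ / 2 * ‖x‖ :=
        (norm_op_le _ _).trans (mul_le_mul_of_nonneg_right hTS (norm_nonneg _))
      have h4 := mul_le_mul_of_nonneg_left h3 (norm_nonneg x)
      rw [h1]
      nlinarith [hco x]
    have hc2 : 0 < c₀ / 2 := by linarith
    have hA₁₄ : 2 * (c₀⁻¹) ^ 2 * A₁ ≤ A₄ := by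
      rw [hA₄_def]
      have : 0 ≤ 16 * (R * K * (c₀⁻¹) ^ 2 * (H * C₂⁻¹)) := by positivity
      linarith
    refine ⟨fun μ hμ => le_of_mem_spectrum_of_coercive hTc hμ,
      isUnit_of_coercive hc2 (hsp.coercive_principalPart_add hTc), ?_, ?_⟩
    · calc _ ≤ (c₀ / 2)⁻¹ * specNorm (T - S) * c₀⁻¹ := specNorm_inv_sub_inv_le hc2 hc₀ hTc hco
        _ ≤ (c₀ / 2)⁻¹ * (A₁ * B) * c₀⁻¹ := by gcongr
        _ = 2 * (c₀⁻¹) ^ 2 * A₁ * B := by rw [inv_div]; ring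
        _ ≤ _ := mul_le_mul_of_nonneg_right (by linarith) hB0
    · have h1 := hsp.specNorm_inv_sub_inv_le hF.symm hc₀ hco hK hb
        (specNorm_le_of_isSparse hF.symm hc₀ hco hq₁ hb0.le hF.sparse) hTS hTc
      have h2 : M * s * (H * (p * β) / eigengap lamBar) ≤ H * C₂⁻¹ * B := by
        have h3 : H * (p * β) / eigengap lamBar ≤ H * (p * β) / (C₂ * p) := by
          have := hF.pervasive
          gcongr
        calc M * s * (H * (p * β) / eigengap lamBar) ≤ M * s * (H * (p * β) / (C₂ * p)) := by
              gcongr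
          _ = H * C₂⁻¹ * (M * s * β) := by field_simp
          _ ≤ _ := by gcongr
      refine h1.trans ?_
      calc _ ≤ 16 * (R * K * (c₀⁻¹) ^ 2 * (H * C₂⁻¹ * B)) + 2 * (c₀⁻¹) ^ 2 * (A₁ * B) := by
            gcongr
        _ = A₄ * B := by rw [hA₄_def]; ring
        _ ≤ _ := mul_le_mul_of_nonneg_right (by linarith) hB0

/-! ### Exceptional events. -/

section Probability

variable {Ω : Type*} [MeasurableSpace Ω] {P : Measure Ω} [IsProbabilityMeasure P]

theorem measureReal_le_add_of_ae {E F : Set Ω} {A : Set Ω}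
    (h : ∀ᵐ ω ∂P, ω ∉ E → ω ∉ F → ω ∉ A) : P.real A ≤ P.real E + P.real F := by
  refine le_trans ?_ (measureReal_union_le E F)
  refine ENNReal.toReal_mono (measure_ne_top _ _) (measure_mono_ae ?_)
  filter_upwards [h] with ω hω hA
  by_contra hEF
  exact hω (fun hE => hEF (Or.inl hE)) (fun hF => hEF (Or.inr hF)) hA

theorem measureReal_ge_le_of_sq {X : Ω → ℝ} (hX : MemLp X 2 P) {K a : ℝ} (ha : 0 < a)
    (hK : ∫ ω, X ω ^ 2 ∂P ≤ K) : P.real {ω | a ≤ X ω} ≤ K / a ^ 2 := by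
  have h1 := mul_meas_ge_le_integral_of_nonneg (μ := P) (f := fun ω => X ω ^ 2)
    (Eventually.of_forall fun ω => sq_nonneg _) hX.integrable_sq (a ^ 2)
  rw [le_div_iff₀ (by positivity)]
  have h2 : P.real {ω | a ≤ X ω} ≤ P.real {ω | a ^ 2 ≤ X ω ^ 2} :=
    measureReal_mono fun ω hω => pow_le_pow_left₀ ha.le hω 2
  nlinarith [sq_nonneg a]

end Probability

end POET

theorem proposition5p1
    -- the constants of the assumptions
    (C₁ C₂ C₃ c₀ Cin ν q : ℝ) (R : ℕ)
    (hC₂ : 0 < C₂) (hc₀ : 0 < c₀) (hCin : 0 < Cin) (hq₀ : 0 ≤ q) (hq₁ : q < 1) :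
    ∃ W : ℝ, 0 < W ∧ ∀ Cw : ℝ, W ≤ Cw → ∃ C c : ℝ, 0 < C ∧ 0 < c ∧
    ∀ {Ω : Type*} [MeasurableSpace Ω] (P : Measure Ω) [IsProbabilityMeasure P]
      -- dimension, rank, tail indices, sparsity level, scale
      (p r : ℕ → ℕ) (tail : ∀ n, Fin (p n) → ℝ) (s : ℕ → ℝ) (M : ℕ → Ω → ℝ)
      -- low-rank part, its eigenvalues and eigenvectors, sparse part
      (Θ : ∀ n, Ω → Matrix (Fin (p n)) (Fin (p n)) ℝ)
      (lamBar : ∀ n, Ω → Fin (r n) → ℝ)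
      (qBar : ∀ n, Ω → Fin (r n) → EuclideanSpace ℝ (Fin (p n)))
      (S : ∀ n, Ω → Matrix (Fin (p n)) (Fin (p n)) ℝ)
      -- input estimator, its eigenvalues and eigenvectors, threshold functions
      (Ghat : ∀ n, Ω → Matrix (Fin (p n)) (Fin (p n)) ℝ)
      (lamHat : ∀ n, Ω → Fin (p n) → ℝ)
      (qHat : ∀ n, Ω → Fin (p n) → EuclideanSpace ℝ (Fin (p n)))
      (t : ∀ n, Ω → Fin (p n) → Fin (p n) → ℝ → ℝ)
      -- derived quantities
      (α x τ : ℕ → ℝ) (β : ℕ → Ω → ℝ)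
      (G Stilde Shat Gpoet : ∀ n, Ω → Matrix (Fin (p n)) (Fin (p n)) ℝ),
      (∀ n, α n = ⨅ i, tail n i) →
      (∀ n, x n = (n : ℝ) ^ (-(1 / 2) : ℝ) * Real.log (p n)) →
      (∀ n, τ n = x n ^ ((α n - 1) / α n)) →
      (∀ n ω, β n ω = M n ω * s (p n) / p n + τ n) →
      (∀ n ω, G n ω = Θ n ω + S n ω) →
      (∀ n ω, Stilde n ω = Ghat n ω - POET.principalPart (r n) (lamHat n ω) (qHat n ω)) →
      (∀ n ω, Shat n ω = POET.thresholded (Cw * β n ω) (t n ω) (Stilde n ω)) →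
      (∀ n ω, Gpoet n ω =
        POET.principalPart (r n) (lamHat n ω) (qHat n ω) + Shat n ω) →
      -- assumptions
      (∀ᶠ n in atTop, 1 ≤ r n ∧ r n ≤ R ∧ ∀ i, 1 < tail n i) →
      (∃ K : ℝ, ∀ᶠ n in atTop, MemLp (M n) 2 P ∧ ∫ ω, M n ω ^ 2 ∂P ≤ K) →
      (∀ᶠ n in atTop, ∀ᵐ ω ∂P, POET.FactorConditions C₁ C₂ C₃ c₀ q (s (p n)) (M n ω)
        (Θ n ω) (S n ω) (lamBar n ω) (qBar n ω)) →
      Tendsto (fun n => s (p n) / √(p n) + τ n) atTop (𝓝 0) →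
      (∀ᶠ n in atTop, ∀ᵐ ω ∂P,
        POET.IsSpectralDecomposition (Ghat n ω) (lamHat n ω) (qHat n ω)) →
      (∀ᶠ n in atTop, P.real {ω | Cin * τ n ≤ POET.maxNorm (Ghat n ω - G n ω)} ≤ (p n : ℝ)⁻¹) →
      (∀ᶠ n in atTop, ∀ᵐ ω ∂P, ∀ i j, i ≠ j → ∀ y,
        |t n ω i j y - y| ≤ POET.thresholdLevel (Cw * β n ω) (Stilde n ω) i j) →
      -- conclusions
      (∀ᶠ n in atTop, P.real {ω | ¬
        (POET.specNorm (Shat n ω - S n ω) ≤ C * (M n ω * s (p n) * β n ω ^ (1 - q)) ∧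
         POET.relFrobNorm (G n ω) (Gpoet n ω - G n ω) ≤
          C * (√(p n) * x n ^ ((2 * α n - 2) / α n) + M n ω * s (p n) * β n ω ^ (1 - q)))}
        < 2 * (p n : ℝ)⁻¹) ∧
      ((∀ᶠ n in atTop, ∀ᵐ ω ∂P, ∀ i, S n ω i i ≤ ν) →
       ∀ᶠ n in atTop, P.real {ω | ¬
        (POET.specNorm (Shat n ω - S n ω) ≤ C * (M n ω * s (p n) * β n ω ^ (1 - q)) ∧
         POET.maxNorm (Shat n ω - S n ω) ≤ C * β n ω ∧
         POET.relFrobNorm (G n ω) (Gpoet n ω - G n ω) ≤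
          C * (√(p n) * x n ^ ((2 * α n - 2) / α n) + M n ω * s (p n) * β n ω ^ (1 - q)) ∧
         POET.maxNorm (Gpoet n ω - G n ω) ≤ C * β n ω)}
        < 2 * (p n : ℝ)⁻¹) ∧
      (TendstoInMeasure P (fun n ω => M n ω * s (p n) * β n ω ^ (1 - q)) atTop (fun _ => 0) →
       Tendsto (fun n => P.real {ω | ¬
        ((∀ μ ∈ spectrum ℝ (Shat n ω), c ≤ μ) ∧
         IsUnit (Gpoet n ω) ∧
         POET.specNorm ((Shat n ω)⁻¹ - (S n ω)⁻¹) ≤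
          C * (M n ω * s (p n) * β n ω ^ (1 - q)) ∧
         POET.specNorm ((Gpoet n ω)⁻¹ - (G n ω)⁻¹) ≤
          C * (M n ω * s (p n) * β n ω ^ (1 - q)))}) atTop (𝓝 0)) := by
  obtain ⟨W, hW, hdet⟩ :=
    POET.exists_deterministic_bounds C₁ C₂ C₃ c₀ Cin ν q R hC₂ hc₀ hCin hq₀ hq₁
  refine ⟨W, hW, fun Cw hCw => ?_⟩
  obtain ⟨C, ε, δ, hC, hε, hδ, hdet⟩ := hdet Cw hCw
  refine ⟨C, c₀ / 2, hC, by positivity, ?_⟩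
  intro Ω _ P _ p r tail s M Θ lamBar qBar S Ghat lamHat qHat t α x τ β G Stilde Shat Gpoet
    _ hx hτ hβ hG hStilde hShat hGpoet hr hM hF hlim hΓ hinput ht
  obtain ⟨K, hM⟩ := hM
  have hx0 : ∀ n, 0 ≤ x n := fun n => by
    rw [hx]; exact mul_nonneg (by positivity) (Real.log_natCast_nonneg _)
  have hτ0 : ∀ n, 0 ≤ τ n := fun n => by rw [hτ]; exact Real.rpow_nonneg (hx0 n) _
  have hτ2 : ∀ n, x n ^ ((2 * α n - 2) / α n) = τ n ^ 2 := fun n => by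
    rw [hτ, ← Real.rpow_natCast, ← Real.rpow_mul (hx0 n)]
    congr 1
    push_cast
    ring
  -- the dimension, the sparsity level and the scale are tied together
  have hbase : ∀ᶠ n in atTop, 0 < (p n : ℝ) ∧ 0 < s (p n) ∧ c₀ ^ 2 ≤ s (p n) ^ 2 * K := by
    filter_upwards [hr, hF, hM] with n hrn hFn hMn
    have hae : ∀ᵐ ω ∂P, c₀ ≤ M n ω * s (p n) := hFn.mono fun ω h => h.le_mul hrn.1 hc₀
    obtain ⟨ω, hω⟩ := hFn.exists
    have hp : 0 < p n := hω.dim_pos hrn.1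
    have hs : 0 < s (p n) :=
      pos_of_mul_pos_right (hc₀.trans_le (hω.le_mul hrn.1 hc₀)) hω.M_pos.le
    refine ⟨by exact_mod_cast hp, hs, ?_⟩
    have h1 : ∫ _ω, c₀ ^ 2 ∂P ≤ ∫ ω, s (p n) ^ 2 * M n ω ^ 2 ∂P := by
      refine integral_mono_ae (integrable_const _) (hMn.1.integrable_sq.const_mul _) ?_
      filter_upwards [hae] with ω hω
      calc c₀ ^ 2 ≤ (M n ω * s (p n)) ^ 2 := pow_le_pow_left₀ hc₀.le hω 2
        _ = _ := by ring
    rw [integral_const, probReal_univ, one_smul, integral_const_mul] at h1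
    exact h1.trans (mul_le_mul_of_nonneg_left hMn.2 (sq_nonneg _))
  have hslim : Tendsto (fun n => s (p n) / √(p n)) atTop (𝓝 0) := by
    refine squeeze_zero' ?_ ?_ hlim
    · filter_upwards [hbase] with n hn
      have := hn.2.1
      positivity
    · exact Eventually.of_forall fun n => by linarith [hτ0 n]
  have hτlim : Tendsto τ atTop (𝓝 0) := by simpa using hlim.sub hslim
  have hsq : ∀ a : ℝ, Tendsto (fun n => a * (s (p n) / √(p n)) ^ 2) atTop (𝓝 0) := fun a => by
    simpa using (hslim.pow 2).const_mul a
  -- Divergence of p is not assumed: c₀² ≤ s²K gives 1/p ≤ (K/c₀²) s²/p → 0.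
  have hpinv : Tendsto (fun n => (p n : ℝ)⁻¹) atTop (𝓝 0) := by
    refine squeeze_zero' (Eventually.of_forall fun n => by positivity) ?_ (hsq (K / c₀ ^ 2))
    filter_upwards [hbase] with n ⟨hp, _, hK⟩
    rw [div_pow, Real.sq_sqrt hp.le, ← one_div, div_mul_div_comm, div_le_div_iff₀ hp
      (by positivity)]
    have := mul_le_mul_of_nonneg_right hK hp.le
    linarith
  -- Chebyshev bounds this by (4K/ε²)(s²/p)/p, eventually strictly below 1/p; this is the source of
  -- the strict inequality in the conclusions.
  have hcheb : ∀ᶠ n in atTop,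
      P.real {ω | ε / 2 * p n / s (p n) ≤ M n ω} < (p n : ℝ)⁻¹ := by
    filter_upwards [hbase, hM, (hsq (4 * K / ε ^ 2)).eventually (gt_mem_nhds one_pos)]
      with n ⟨hp, hs, _⟩ hMn hsmall
    refine (POET.measureReal_ge_le_of_sq hMn.1 (by positivity) hMn.2).trans_lt ?_
    rw [div_pow, Real.sq_sqrt hp.le] at hsmall
    calc K / (ε / 2 * p n / s (p n)) ^ 2
        = 4 * K / ε ^ 2 * (s (p n) ^ 2 / p n) * (p n : ℝ)⁻¹ := by
          field_simp
          ring
      _ < 1 * (p n : ℝ)⁻¹ := mul_lt_mul_of_pos_right hsmall (by positivity)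
      _ = (p n : ℝ)⁻¹ := one_mul _
  -- Off the two events β = M s / p + τ ≤ ε/2 + ε/2, so the deterministic bounds apply.
  have hgood : ∀ᶠ n in atTop, ∀ᵐ ω ∂P,
      ω ∉ {ω | Cin * τ n ≤ POET.maxNorm (Ghat n ω - G n ω)} →
      ω ∉ {ω | ε / 2 * p n / s (p n) ≤ M n ω} →
      (POET.specNorm (Shat n ω - S n ω) ≤ C * (M n ω * s (p n) * β n ω ^ (1 - q)) ∧
       POET.relFrobNorm (G n ω) (Gpoet n ω - G n ω) ≤
        C * (√(p n) * x n ^ ((2 * α n - 2) / α n) + M n ω * s (p n) * β n ω ^ (1 - q)) ∧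
       ((∀ i, S n ω i i ≤ ν) → POET.maxNorm (Shat n ω - S n ω) ≤ C * β n ω ∧
        POET.maxNorm (Gpoet n ω - G n ω) ≤ C * β n ω) ∧
       (M n ω * s (p n) * β n ω ^ (1 - q) ≤ δ →
        (∀ μ ∈ spectrum ℝ (Shat n ω), c₀ / 2 ≤ μ) ∧ IsUnit (Gpoet n ω) ∧
        POET.specNorm ((Shat n ω)⁻¹ - (S n ω)⁻¹) ≤
          C * (M n ω * s (p n) * β n ω ^ (1 - q)) ∧
        POET.specNorm ((Gpoet n ω)⁻¹ - (G n ω)⁻¹) ≤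
          C * (M n ω * s (p n) * β n ω ^ (1 - q)))) := by
    filter_upwards [hr, hF, hΓ, ht, hbase, hτlim.eventually (gt_mem_nhds (half_pos hε))]
      with n hrn hFn hΓn htn ⟨hp, hs, _⟩ hτn
    filter_upwards [hFn, hΓn, htn] with ω hFω hΓω htω h1 h2
    have h1' : POET.maxNorm (Ghat n ω - G n ω) < Cin * τ n := not_le.1 h1
    have h2' : M n ω < ε / 2 * p n / s (p n) := not_le.1 h2
    have hβε : β n ω ≤ ε := by
      rw [lt_div_iff₀ hs, ← div_lt_iff₀ hp] at h2'
      rw [hβ]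
      linarith
    rw [hG] at h1'
    have := hdet hrn.1 hrn.2.1 (hτ0 n) (hβ n ω) hFω hΓω h1'.le (hStilde n ω) (hShat n ω)
      htω hβε
    rw [hτ2, hG, hGpoet]
    exact this
  refine ⟨?_, fun hν => ?_, fun hB => ?_⟩
  · filter_upwards [hgood, hinput, hcheb] with n hgn hin hch
    refine (POET.measureReal_le_add_of_ae ?_).trans_lt
      ((add_lt_add_of_le_of_lt hin hch).trans_eq (two_mul _).symm)
    filter_upwards [hgn] with ω hω h1 h2
    have := hω h1 h2
    exact not_not_intro ⟨this.1, this.2.1⟩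
  · filter_upwards [hgood, hinput, hcheb, hν] with n hgn hin hch hνn
    refine (POET.measureReal_le_add_of_ae ?_).trans_lt
      ((add_lt_add_of_le_of_lt hin hch).trans_eq (two_mul _).symm)
    filter_upwards [hgn, hνn] with ω hω hνω h1 h2
    have := hω h1 h2
    exact not_not_intro ⟨this.1, (this.2.2.1 hνω).1, this.2.1, (this.2.2.1 hνω).2⟩
  -- The bad event costs at most 2/p plus the probability that M s β^(1-q) reaches δ, and both tend
  -- to 0.
  · have hBδ := tendstoInMeasure_iff_measureReal_norm.1 hB δ hδ
    have hlim' := ((hpinv.add hpinv).add hBδ)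
    rw [add_zero, add_zero] at hlim'
    refine squeeze_zero' (Eventually.of_forall fun n => measureReal_nonneg) ?_ hlim'
    filter_upwards [hgood, hinput, hcheb] with n hgn hin hch
    refine (POET.measureReal_le_add_of_ae
      (E := {ω | Cin * τ n ≤ POET.maxNorm (Ghat n ω - G n ω)} ∪
        {ω | ε / 2 * p n / s (p n) ≤ M n ω})
      (F := {ω | δ ≤ ‖M n ω * s (p n) * β n ω ^ (1 - q) - 0‖}) ?_).trans
      (add_le_add ((measureReal_union_le _ _).trans (add_le_add hin hch.le)) le_rfl)
    filter_upwards [hgn] with ω hω h12 h3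
    have h4 := hω (fun h => h12 (Or.inl h)) (fun h => h12 (Or.inr h))
    refine not_not_intro (h4.2.2.2 ?_)
    have h5 : ‖M n ω * s (p n) * β n ω ^ (1 - q) - 0‖ < δ := not_le.1 h3
    rw [sub_zero] at h5
    exact (le_abs_self _).trans h5.le
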